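/- Let $\lambda_0,\lambda_1>0$ and $\gamma_0>0>\gamma_1$. Let $\varepsilon=(\varepsilon(t))_{t\ge 0}$ be a right-continuous two-state Markov process on $\{0,1\}$ which leaves state $i$ with rate $\lambda_i$; that is, its states alternate and, given $\varepsilon(0)=i$, its successive holding times are independent and exponentially distributed with the rates $\lambda_i,\lambda_{1-i},\lambda_i,\dots$. Let $\tau_0=0<\tau_1<\tau_2<\dots$ be its switching times, $N(t)=\#\{k\ge1:\tau_k\le t\}$ the number of switchings up to time $t$, and $$\Gamma(t)=\int_0^t\gamma_{\varepsilon(s)}\,ds,\qquad m_t=\min_{0\le u\le t}\Gamma(u),\qquad M_t=\max_{0\le u\le t}\Gamma(u).$$ Write $\mathrm P_i=\mathrm P\{\,\cdot\mid\varepsilon(0)=i\}$ (for $i$ with $\mathrm P\{\varepsilon(0)=i\}>0$), and put $$\xi_0(t,x)=\frac{x-\gamma_1t}{\gamma_0-\gamma_1},\quad \xi_1(t,x)=\frac{\gamma_0t-x}{\gamma_0-\gamma_1},\quad z(t,x)=\lambda_0\lambda_1\xi_0(t,x)\xi_1(t,x),\quad \theta(t,x)=\frac{e^{-\lambda_0\xi_0(t,x)-\lambda_1\xi_1(t,x)}}{\gamma_0-\gamma_1},$$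 and, for $\gamma_1t<x<\gamma_0t$, $$\mathcal I_0(t,x)=\sum_{n\ge0}\frac{z(t,x)^n}{n!^2}=I_0\big(2\sqrt{z(t,x)}\big),\qquad \mathcal I_1(t,x)=\sum_{n\ge0}\frac{z(t,x)^n}{n!\,(n+1)!}=\frac{I_1\big(2\sqrt{z(t,x)}\big)}{\sqrt{z(t,x)}},$$ where $I_0,I_1$ are the modified Bessel functions of the first kind. Let $t>0$. (a) Positive meander. $\mathrm P_0\{\Gamma(t)\in dx,\ m_t=0,\ N(t)=0\}=e^{-\lambda_0t}\delta_{\gamma_0t}(dx)$, and for every $n\ge0$ $$\mathrm P_0\{\Gamma(t)\in dx,\ m_t=0,\ N(t)=2n+1\}=\frac{\lambda_0}{\xi_0(t,x)}\,\frac{z(t,x)^n}{n!^2}\,\theta(t,x)\,\frac1{\gamma_0}\Big(x-\frac{\gamma_1}{n+1}\xi_1(t,x)\Big)\mathbf 1_{\{0<x<\gamma_0t\}}\,dx,$$ $$\mathrm P_0\{\Gamma(t)\in dx,\ m_t=0,\ N(t)=2n+2\}=\lambda_0\lambda_1\,\frac{z(t,x)^n}{n!\,(n+1)!}\,\theta(t,x)\,\frac{x}{\gamma_0}\,\mathbf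 1_{\{0<x<\gamma_0t\}}\,dx.$$ Summed over the number of switchings, $$\mathrm P_0\{\Gamma(t)\in dx,\ m_t=0\}=e^{-\lambda_0t}\delta_{\gamma_0t}(dx)+\frac{\lambda_0}{\gamma_0}\Big[\frac{x}{\xi_0(t,x)}\mathcal I_0(t,x)+\Big(\lambda_1x-\gamma_1\frac{\xi_1(t,x)}{\xi_0(t,x)}\Big)\mathcal I_1(t,x)\Big]\theta(t,x)\mathbf 1_{\{0<x<\gamma_0t\}}\,dx.$$ (b) Negative meander. $\mathrm P_1\{\Gamma(t)\in dx,\ M_t=0,\ N(t)=0\}=e^{-\lambda_1t}\delta_{\gamma_1t}(dx)$, and for every $n\ge0$ $$\mathrm P_1\{\Gamma(t)\in dx,\ M_t=0,\ N(t)=2n+1\}=\frac{\lambda_1}{\xi_1(t,x)}\,\frac{z(t,x)^n}{n!^2}\,\theta(t,x)\,\frac1{\gamma_1}\Big(x-\frac{\gamma_0}{n+1}\xi_0(t,x)\Big)\mathbf 1_{\{\gamma_1t<x<0\}}\,dx,$$ $$\mathrm P_1\{\Gamma(t)\in dx,\ M_t=0,\ N(t)=2n+2\}=\lambda_0\lambda_1\,\frac{z(t,x)^n}{n!\,(n+1)!}\,\theta(t,x)\,\frac{x}{\gamma_1}\,\mathbf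 1_{\{\gamma_1t<x<0\}}\,dx.$$ Summed over the number of switchings, $$\mathrm P_1\{\Gamma(t)\in dx,\ M_t=0\}=e^{-\lambda_1t}\delta_{\gamma_1t}(dx)+\frac{\lambda_1}{\gamma_1}\Big[\frac{x}{\xi_1(t,x)}\mathcal I_0(t,x)+\Big(\lambda_0x-\gamma_0\frac{\xi_0(t,x)}{\xi_1(t,x)}\Big)\mathcal I_1(t,x)\Big]\theta(t,x)\mathbf 1_{\{\gamma_1t<x<0\}}\,dx.$$ -/

import Mathlib

open Real Set Filter Topology MeasureTheory ProbabilityTheory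
open scoped Nat ENNReal

namespace Telegraph

noncomputable section

variable {Ω : Type*} [MeasurableSpace Ω]

/-- The conditional probability `P_i = P(· | ε(0) = i)`. -/
def startedAt (P : Measure Ω) (ε : ℝ → Ω → Fin 2) (i : Fin 2) : Measure Ω :=
  ProbabilityTheory.cond P {ω | ε 0 ω = i}

/-- `τ 0 = 0 < τ 1 < τ 2 < …` is the increasing enumeration of all the switching times of the
(right-continuous, piecewise constant) path `path : [0, ∞) → {0, 1}`. -/
structure IsSwitchingTimes (path : ℝ → Fin 2) (τ : ℕ → ℝ) : Prop where
  zero : τ 0 = 0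
  strictMono : StrictMono τ
  tendsto_atTop : Tendsto τ atTop atTop
  constant : ∀ n, ∀ s ∈ Ico (τ n) (τ (n + 1)), path s = path (τ n)
  switch : ∀ n, path (τ (n + 1)) ≠ path (τ n)

/-- `ε(t)`, `t ≥ 0`, is a right-continuous two-state Markov process on `{0, 1}` which leaves
state `i` with rate `lam i`, and `τ n` are its switching times. The process is described by its
jump chain and its holding times: the states alternate and, given `ε(0) = i`, the holding times
`τ (n + 1) - τ n` are independent and exponentially distributed, with the rates
`lam i, lam (1 - i), lam i, …` of the successively visited states. -/
structure IsTwoStateMarkov (P : Measure Ω) (lam : Fin 2 → ℝ) (ε : ℝ → Ω → Fin 2)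
    (τ : ℕ → Ω → ℝ) : Prop where
  measurable_state : ∀ t, 0 ≤ t → Measurable (ε t)
  switching : ∀ᵐ ω ∂P, IsSwitchingTimes (fun s => ε s ω) (fun n => τ n ω)
  holding_law : ∀ i : Fin 2, P {ω | ε 0 ω = i} ≠ 0 → ∀ n : ℕ,
    HasLaw (fun ω => τ (n + 1) ω - τ n ω)
      (expMeasure (lam (if Even n then i else 1 - i))) (startedAt P ε i)
  holding_indep : ∀ i : Fin 2, P {ω | ε 0 ω = i} ≠ 0 →
    iIndepFun (fun (n : ℕ) ω => τ (n + 1) ω - τ n ω) (startedAt P ε i)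

/-- `N(t)`, the number of switchings up to time `t`. -/
def numSwitches (τ : ℕ → Ω → ℝ) (t : ℝ) (ω : Ω) : ℕ :=
  {k : ℕ | 1 ≤ k ∧ τ k ω ≤ t}.ncard

/-- The telegraph process `Γ(t) = ∫₀ᵗ γ_{ε(s)} ds`. -/
def position (γ : Fin 2 → ℝ) (ε : ℝ → Ω → Fin 2) (t : ℝ) (ω : Ω) : ℝ :=
  ∫ s in (0 : ℝ)..t, γ (ε s ω)

/-- The running minimum `m_t = min_{0 ≤ u ≤ t} Γ(u)`. -/
def runMin (γ : Fin 2 → ℝ) (ε : ℝ → Ω → Fin 2) (t : ℝ) (ω : Ω) : ℝ :=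
  sInf ((fun u => position γ ε u ω) '' Icc 0 t)

/-- The running maximum `M_t = max_{0 ≤ u ≤ t} Γ(u)`. -/
def runMax (γ : Fin 2 → ℝ) (ε : ℝ → Ω → Fin 2) (t : ℝ) (ω : Ω) : ℝ :=
  sSup ((fun u => position γ ε u ω) '' Icc 0 t)

/-- The positive telegraphic meander `{Γ(t) ∈ B, m_t = 0, N(t) = n}`. -/
def posMeander (γ : Fin 2 → ℝ) (ε : ℝ → Ω → Fin 2) (τ : ℕ → Ω → ℝ) (t : ℝ) (B : Set ℝ)
    (n : ℕ) : Set Ω :=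
  {ω | position γ ε t ω ∈ B ∧ runMin γ ε t ω = 0 ∧ numSwitches τ t ω = n}

/-- The negative telegraphic meander `{Γ(t) ∈ B, M_t = 0, N(t) = n}`. -/
def negMeander (γ : Fin 2 → ℝ) (ε : ℝ → Ω → Fin 2) (τ : ℕ → Ω → ℝ) (t : ℝ) (B : Set ℝ)
    (n : ℕ) : Set Ω :=
  {ω | position γ ε t ω ∈ B ∧ runMax γ ε t ω = 0 ∧ numSwitches τ t ω = n}

/-- `ξ₀(t, x) = (x - γ₁ t) / (γ₀ - γ₁)`. -/
def xi0 (γ : Fin 2 → ℝ) (t x : ℝ) : ℝ := (x - γ 1 * t) / (γ 0 - γ 1)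

/-- `ξ₁(t, x) = (γ₀ t - x) / (γ₀ - γ₁)`. -/
def xi1 (γ : Fin 2 → ℝ) (t x : ℝ) : ℝ := (γ 0 * t - x) / (γ 0 - γ 1)

/-- `z(t, x) = λ₀ λ₁ ξ₀(t, x) ξ₁(t, x)`. -/
def zfun (lam γ : Fin 2 → ℝ) (t x : ℝ) : ℝ := lam 0 * lam 1 * xi0 γ t x * xi1 γ t x

/-- `θ(t, x) = exp (-λ₀ ξ₀(t, x) - λ₁ ξ₁(t, x)) / (γ₀ - γ₁)`. -/
def theta (lam γ : Fin 2 → ℝ) (t x : ℝ) : ℝ :=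
  Real.exp (-lam 0 * xi0 γ t x - lam 1 * xi1 γ t x) / (γ 0 - γ 1)

/-- The modified Bessel function of the first kind `I_k`, of integer order `k ≥ 0`. -/
def besselI (k : ℕ) (y : ℝ) : ℝ :=
  ∑' n : ℕ, (y / 2) ^ (2 * n + k) / ((n ! : ℝ) * ((n + k)! : ℝ))

/-- `𝓘₀(t, x) = ∑ₙ z(t, x)ⁿ / n!²`. -/
def calI0 (lam γ : Fin 2 → ℝ) (t x : ℝ) : ℝ :=
  ∑' n : ℕ, zfun lam γ t x ^ n / (n ! : ℝ) ^ 2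

/-- `𝓘₁(t, x) = ∑ₙ z(t, x)ⁿ / (n! (n + 1)!)`. -/
def calI1 (lam γ : Fin 2 → ℝ) (t x : ℝ) : ℝ :=
  ∑' n : ℕ, zfun lam γ t x ^ n / ((n ! : ℝ) * ((n + 1)! : ℝ))

end

end Telegraph

/-!
Condition on the starting state `0` and let `U` and `D` be the total times spent in the upward
state `0` and the downward state `1`. The meander with exactly `k` switchings is an event on the
first `k + 1` holding times: all turning points of the path are nonnegative, the current sojourn
covers the time `t`, and the endpoint is nonnegative (`mem_posMeander_iff`). So it suffices to know
the law of `(U, D)` after `k` sojourns on the event that the turning points are nonnegative.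

From the second sojourn on, this law has a density of the form `exp (-lam 0 * u - lam 1 * d)` times
a power of each rate times a polynomial in `(u, d)`. Adding one more exponential sojourn multiplies
by its rate and integrates the polynomial in the variable which grows
(`lintegral_add_exponential`); the constraint then cuts the result down to the cone
`0 ≤ γ 0 * u + γ 1 * d`. The polynomials are therefore determined by the recursion that `oddPoly n`
is the primitive in `u` of `evenPoly n` which vanishes on the boundary of the cone, and
`evenPoly (n + 1)` is the primitive in `d` of `oddPoly n` which vanishes at `d = 0`. Their closed
forms are those of the ballot theorem: `oddPoly n` is `u ^ (n + 1) / (n + 1)! * (d ^ n / n !)` times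
the probability `1 - r * d / u`, with `r = -γ 1 / γ 0`.

The sojourn in progress at time `t` performs the same integration
(`lintegral_exponential_overshoot`), so that the density of the endpoint is the next polynomial,
evaluated at the point `(u, d) = (xi0 γ t x, xi1 γ t x)` where `u + d = t` and the position is `x`.
The summed formula follows by adding up the series, and the negative meander is the positive meander
of the process in which the two states are interchanged and the speeds change their signs.
-/

namespace Telegraph

/-! ### Adding an independent exponential variable -/

section

variable {Ω : Type*} [MeasurableSpace Ω]

lemma expMeasure_eq_withDensity (l : ℝ) :
    expMeasure l = volume.withDensity (exponentialPDF l) := rfl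

lemma measurable_exponentialPDF (l : ℝ) : Measurable (exponentialPDF l) :=
  (measurable_exponentialPDFReal l).ennreal_ofReal

lemma expMeasure_Ioi {l : ℝ} (hl : 0 < l) {s : ℝ} (hs : 0 ≤ s) :
    expMeasure l (Ioi s) = ENNReal.ofReal (exp (-l * s)) := by
  have := isProbabilityMeasure_expMeasure hl
  have h := cdf_expMeasure_eq hl s
  rw [if_pos hs, cdf_eq_real] at h
  rw [← compl_Iic, prob_compl_eq_one_sub measurableSet_Iic, ← ofReal_measureReal, h,
    ← ENNReal.ofReal_one, ← ENNReal.ofReal_sub]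
  · congr 1
    ring_nf
  · have : exp (-(l * s)) ≤ 1 := exp_le_one_iff.2 (by nlinarith)
    linarith

/-- Integrating out a random variable `X` which is independent of the rest. -/
lemma lintegral_mul_indepFun {Q : Measure Ω} [IsProbabilityMeasure Q] {A B X : Ω → ℝ}
    {W : Ω → ℝ≥0∞} (hA : Measurable A) (hB : Measurable B) (hX : Measurable X)
    (hW : Measurable W) (hind : IndepFun (fun ω => (A ω, B ω, W ω)) X Q)
    {G : ℝ → ℝ → ℝ → ℝ≥0∞} (hG : Measurable fun p : ℝ × ℝ × ℝ => G p.1 p.2.1 p.2.2) :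
    ∫⁻ ω, W ω * G (A ω) (B ω) (X ω) ∂Q
      = ∫⁻ ω, W ω * ∫⁻ x, G (A ω) (B ω) x ∂(Q.map X) ∂Q := by
  have hY : Measurable fun ω => (A ω, B ω, W ω) := by fun_prop
  have hmap := (indepFun_iff_map_prod_eq_prod_map_map hY.aemeasurable hX.aemeasurable).1 hind
  have := Measure.isProbabilityMeasure_map hX.aemeasurable (μ := Q)
  have := Measure.isProbabilityMeasure_map hY.aemeasurable (μ := Q)
  have hG' : Measurable fun p : (ℝ × ℝ × ℝ≥0∞) × ℝ => p.1.2.2 * G p.1.1 p.1.2.1 p.2 :=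
    (by fun_prop : Measurable fun p : (ℝ × ℝ × ℝ≥0∞) × ℝ => p.1.2.2).mul
      (hG.comp (by fun_prop : Measurable fun p : (ℝ × ℝ × ℝ≥0∞) × ℝ => (p.1.1, p.1.2.1, p.2)))
  calc ∫⁻ ω, W ω * G (A ω) (B ω) (X ω) ∂Q
      = ∫⁻ p, p.1.2.2 * G p.1.1 p.1.2.1 p.2 ∂(Q.map fun ω => ((A ω, B ω, W ω), X ω)) := by
        rw [lintegral_map hG' (hY.prodMk hX)]
    _ = ∫⁻ ω, ∫⁻ x, W ω * G (A ω) (B ω) x ∂(Q.map X) ∂Q := by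
        rw [hmap, lintegral_prod _ hG'.aemeasurable,
          lintegral_map hG'.lintegral_prod_right' hY]
    _ = _ := by
        refine lintegral_congr fun ω => ?_
        rw [lintegral_const_mul]
        exact hG.comp (by fun_prop : Measurable fun x : ℝ => (A ω, B ω, x))

/-- Convolution with an exponential law multiplies the exponential factors to a function of the sum
alone, so that only the integral of the remaining density `k` is left. -/
lemma lintegral_exp_mul_expMeasure_add {ν : Measure ℝ} [SFinite ν] {k : ℝ → ℝ≥0∞}
    (hk : Measurable k) {f : ℝ → ℝ≥0∞} (hf : Measurable f) {l : ℝ} (hl : 0 < l) (c : ℝ) :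
    ∫⁻ a, ENNReal.ofReal (exp (-l * a - c)) * k a * ∫⁻ x, f (a + x) ∂(expMeasure l) ∂ν
      = ∫⁻ v, ENNReal.ofReal (exp (-l * v - c)) *
          (ENNReal.ofReal l * ∫⁻ a in Iic v, k a ∂ν) * f v := by
  have hp := measurable_exponentialPDF l
  have h1 : ∀ a, ENNReal.ofReal (exp (-l * a - c)) * k a * ∫⁻ x, f (a + x) ∂(expMeasure l)
      = ∫⁻ v, ENNReal.ofReal (exp (-l * a - c)) * k a * (exponentialPDF l (v - a) * f v) := by
    intro a
    rw [lintegral_const_mul _ (by fun_prop), expMeasure_eq_withDensity,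
      lintegral_withDensity_eq_lintegral_mul _ hp (by fun_prop),
      ← lintegral_sub_right_eq_self _ a]
    simp
  simp_rw [h1]
  rw [lintegral_lintegral_swap (by fun_prop)]
  refine lintegral_congr fun v => ?_
  have h2 : ∀ a, ENNReal.ofReal (exp (-l * a - c)) * k a * (exponentialPDF l (v - a) * f v)
      = ENNReal.ofReal (exp (-l * v - c)) * ENNReal.ofReal l * f v * (Iic v).indicator k a := by
    intro a
    by_cases hav : a ≤ v
    · rw [indicator_of_mem (by exact hav), exponentialPDF_of_nonneg (by linarith),
        ENNReal.ofReal_mul hl.le]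
      have : ENNReal.ofReal (exp (-l * v - c))
          = ENNReal.ofReal (exp (-l * a - c)) * ENNReal.ofReal (exp (-(l * (v - a)))) := by
        rw [← ENNReal.ofReal_mul (exp_nonneg _), ← exp_add]
        congr 2
        ring
      rw [this]
      ring
    · rw [indicator_of_notMem (by exact hav), exponentialPDF_of_neg (by linarith)]
      simp
  simp_rw [h2]
  rw [lintegral_const_mul _ (hk.indicator measurableSet_Iic), lintegral_indicator measurableSet_Iic]
  ring

/-- How the (weighted) law of a pair `(A, B)` changes when an independent exponential variable is
added to `A`: relative to the exponential factor `exp (-l a - m b)`, the density is integrated in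
its first argument and multiplied by the rate. -/
lemma lintegral_add_exponential {Q : Measure Ω} [IsProbabilityMeasure Q] {A B X : Ω → ℝ}
    {W : Ω → ℝ≥0∞} (hA : Measurable A) (hB : Measurable B) (hX : Measurable X)
    (hW : Measurable W) (hind : IndepFun (fun ω => (A ω, B ω, W ω)) X Q)
    {l m : ℝ} (hl : 0 < l) (hlaw : Q.map X = expMeasure l)
    {ν₁ ν₂ : Measure ℝ} [SFinite ν₁] {K : ℝ → ℝ → ℝ≥0∞}
    (hK : Measurable (Function.uncurry K))
    (h : ∀ F : ℝ → ℝ → ℝ≥0∞, Measurable (Function.uncurry F) →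
      ∫⁻ ω, W ω * F (A ω) (B ω) ∂Q
        = ∫⁻ b, ∫⁻ a, ENNReal.ofReal (exp (-l * a - m * b)) * K a b * F a b ∂ν₁ ∂ν₂)
    {F : ℝ → ℝ → ℝ≥0∞} (hF : Measurable (Function.uncurry F)) :
    ∫⁻ ω, W ω * F (A ω + X ω) (B ω) ∂Q
      = ∫⁻ b, ∫⁻ v, ENNReal.ofReal (exp (-l * v - m * b)) *
          (ENNReal.ofReal l * ∫⁻ a in Iic v, K a b ∂ν₁) * F v b ∂volume ∂ν₂ := by
  have := isProbabilityMeasure_expMeasure hl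
  rw [lintegral_mul_indepFun hA hB hX hW hind (G := fun a b x => F (a + x) b)
    (hF.comp (by fun_prop : Measurable fun p : ℝ × ℝ × ℝ => (p.1 + p.2.2, p.2.1))), hlaw,
    h (fun a b => ∫⁻ x, F (a + x) b ∂(expMeasure l))]
  · refine lintegral_congr fun b => ?_
    exact lintegral_exp_mul_expMeasure_add (hK.comp (measurable_id.prodMk measurable_const))
      (f := fun a => F a b) (hF.comp (measurable_id.prodMk measurable_const)) hl (m * b)
  · exact Measurable.lintegral_prod_right' (f := fun p : (ℝ × ℝ) × ℝ => F (p.1.1 + p.2) p.1.2)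
      (hF.comp (by fun_prop : Measurable fun p : (ℝ × ℝ) × ℝ => (p.1.1 + p.2, p.1.2)))

/-- The (weighted) probability that the sojourn of length `X`, which starts at time `A + B`, covers
the time `t`, in terms of the law of `(A, B)`. -/
lemma lintegral_exponential_overshoot {Q : Measure Ω} [IsProbabilityMeasure Q] {A B X : Ω → ℝ}
    {W : Ω → ℝ≥0∞} (hA : Measurable A) (hB : Measurable B) (hX : Measurable X)
    (hW : Measurable W) (hind : IndepFun (fun ω => (A ω, B ω, W ω)) X Q)
    {l m : ℝ} (hl : 0 < l) (hlaw : Q.map X = expMeasure l)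
    {ν₁ ν₂ : Measure ℝ} {K : ℝ → ℝ → ℝ≥0∞}
    (hK : Measurable (Function.uncurry K))
    (h : ∀ F : ℝ → ℝ → ℝ≥0∞, Measurable (Function.uncurry F) →
      ∫⁻ ω, W ω * F (A ω) (B ω) ∂Q
        = ∫⁻ b, ∫⁻ a, ENNReal.ofReal (exp (-l * a - m * b)) * K a b * F a b ∂ν₁ ∂ν₂)
    (t : ℝ) {S : Set ℝ} (hS : MeasurableSet S) :
    ∫⁻ ω, W ω * {p : ℝ × ℝ × ℝ | p.1 + p.2.1 ≤ t ∧ t < p.1 + p.2.1 + p.2.2 ∧ p.2.1 ∈ S}.indicator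
        1 (A ω, B ω, X ω) ∂Q
      = ∫⁻ b, S.indicator 1 b * (ENNReal.ofReal (exp (-l * (t - b) - m * b)) *
          ∫⁻ a in Iic (t - b), K a b ∂ν₁) ∂ν₂ := by
  have := isProbabilityMeasure_expMeasure hl
  set T := {p : ℝ × ℝ × ℝ | p.1 + p.2.1 ≤ t ∧ t < p.1 + p.2.1 + p.2.2 ∧ p.2.1 ∈ S} with hT
  have hTm : MeasurableSet T := by
    have h1 : Measurable fun p : ℝ × ℝ × ℝ => p.1 + p.2.1 := by fun_prop
    have h2 : Measurable fun p : ℝ × ℝ × ℝ => p.1 + p.2.1 + p.2.2 := by fun_prop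
    have h3 : Measurable fun p : ℝ × ℝ × ℝ => p.2.1 := by fun_prop
    exact (measurableSet_le h1 measurable_const).inter
      ((measurableSet_lt measurable_const h2).inter (h3 hS))
  set H : ℝ → ℝ → ℝ≥0∞ := fun a b => S.indicator 1 b *
    (Iic (t - b)).indicator (fun a => ENNReal.ofReal (exp (-l * (t - a - b)))) a with hH
  have hHm : Measurable (Function.uncurry H) := by
    refine ((measurable_one.indicator hS).comp measurable_snd).mul ?_
    have : (fun p : ℝ × ℝ => (Iic (t - p.2)).indicator
        (fun a => ENNReal.ofReal (exp (-l * (t - a - p.2)))) p.1)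
        = {p : ℝ × ℝ | p.1 ≤ t - p.2}.indicator
          (fun p => ENNReal.ofReal (exp (-l * (t - p.1 - p.2)))) := by
      ext p
      simp [indicator]
    rw [this]
    exact Measurable.indicator (by fun_prop) (measurableSet_le (by fun_prop) (by fun_prop))
  have hinner : ∀ a b, ∫⁻ x, T.indicator 1 (a, b, x) ∂(expMeasure l) = H a b := by
    intro a b
    by_cases hab : a + b ≤ t ∧ b ∈ S
    · have h1 : ∀ x, T.indicator (1 : ℝ × ℝ × ℝ → ℝ≥0∞) (a, b, x)
          = (Ioi (t - a - b)).indicator 1 x := by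
        intro x
        simp only [hT, indicator, mem_ofPred_eq, mem_Ioi, hab, true_and, and_true]
        congr 1
        simp only [eq_iff_iff]
        constructor <;> intro <;> linarith
      simp_rw [h1]
      rw [lintegral_indicator_one measurableSet_Ioi, expMeasure_Ioi hl (by linarith [hab.1])]
      rw [hH]
      simp only
      rw [indicator_of_mem hab.2, indicator_of_mem (by simp only [mem_Iic]; linarith [hab.1])]
      simp
    · have h1 : ∀ x, T.indicator (1 : ℝ × ℝ × ℝ → ℝ≥0∞) (a, b, x) = 0 := by
        intro x
        refine indicator_of_notMem (fun hx => hab ⟨hx.1, hx.2.2⟩) _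
      simp_rw [h1]
      rw [lintegral_zero, eq_comm, hH]
      simp only [mul_eq_zero, indicator_apply_eq_zero, mem_Iic]
      by_cases hb : b ∈ S
      · right
        intro ha
        exact absurd ⟨by linarith, hb⟩ hab
      · exact Or.inl fun h => absurd h hb
  rw [lintegral_mul_indepFun hA hB hX hW hind (G := fun a b x => T.indicator 1 (a, b, x))
    (measurable_one.indicator hTm), hlaw]
  simp_rw [hinner]
  rw [h H hHm]
  refine lintegral_congr fun b => ?_
  have hKb : Measurable fun a => K a b := hK.comp (measurable_id.prodMk measurable_const)
  have h2 : ∀ a, ENNReal.ofReal (exp (-l * a - m * b)) * K a b * H a b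
      = (S.indicator 1 b * ENNReal.ofReal (exp (-l * (t - b) - m * b))) *
        (Iic (t - b)).indicator (fun a => K a b) a := by
    intro a
    by_cases hab : a ≤ t - b
    · simp only [hH]
      rw [indicator_of_mem (show a ∈ Iic (t - b) from hab),
        indicator_of_mem (show a ∈ Iic (t - b) from hab)]
      have : ENNReal.ofReal (exp (-l * (t - b) - m * b))
          = ENNReal.ofReal (exp (-l * a - m * b)) * ENNReal.ofReal (exp (-l * (t - a - b))) := by
        rw [← ENNReal.ofReal_mul (exp_nonneg _), ← exp_add]
        congr 2
        ring
      rw [this]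
      ring
    · simp only [hH]
      rw [indicator_of_notMem (show a ∉ Iic (t - b) from hab),
        indicator_of_notMem (show a ∉ Iic (t - b) from hab)]
      simp
  simp_rw [h2]
  rw [lintegral_const_mul _ (hKb.indicator measurableSet_Iic),
    lintegral_indicator measurableSet_Iic, mul_assoc]

end

/-! ### Paths and their holding times -/

section

/-- The total time spent in the upward state `0` during the first `k` sojourns, when these have the
lengths `x 0, x 1, …` and the first of them is upward. -/
noncomputable def upTime (x : ℕ → ℝ) (k : ℕ) : ℝ := ∑ j ∈ Finset.range k, if Even j then x j else 0

/-- The total time spent in the downward state `1` during the first `k` sojourns. -/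
noncomputable def downTime (x : ℕ → ℝ) (k : ℕ) : ℝ :=
  ∑ j ∈ Finset.range k, if Even j then 0 else x j

/-- The position after the first `k` sojourns. -/
noncomputable def height (γ : Fin 2 → ℝ) (x : ℕ → ℝ) (k : ℕ) : ℝ :=
  γ 0 * upTime x k + γ 1 * downTime x k

/-- The sequences of holding times for which the turning points with the indices `0, …, k` are
nonnegative. -/
def staysNonneg (γ : Fin 2 → ℝ) (k : ℕ) : Set (ℕ → ℝ) := {x | ∀ j ≤ k, 0 ≤ height γ x j}

section Sequences

variable {γ : Fin 2 → ℝ} {x : ℕ → ℝ} {k : ℕ}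

@[simp] lemma upTime_zero : upTime x 0 = 0 := by simp [upTime]

@[simp] lemma downTime_zero : downTime x 0 = 0 := by simp [downTime]

lemma upTime_succ_of_even (h : Even k) : upTime x (k + 1) = upTime x k + x k := by
  simp [upTime, Finset.sum_range_succ, h]

lemma upTime_succ_of_odd (h : ¬Even k) : upTime x (k + 1) = upTime x k := by
  simp [upTime, Finset.sum_range_succ, h]

lemma downTime_succ_of_even (h : Even k) : downTime x (k + 1) = downTime x k := by
  simp [downTime, Finset.sum_range_succ, h]

lemma downTime_succ_of_odd (h : ¬Even k) : downTime x (k + 1) = downTime x k + x k := by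
  simp [downTime, Finset.sum_range_succ, h]

lemma height_succ : height γ x (k + 1) = height γ x k + γ (if Even k then 0 else 1) * x k := by
  by_cases h : Even k
  · rw [height, upTime_succ_of_even h, downTime_succ_of_even h, height, if_pos h]
    ring
  · rw [height, upTime_succ_of_odd h, downTime_succ_of_odd h, height, if_neg h]
    ring

lemma upTime_add_downTime_succ :
    upTime x (k + 1) + downTime x (k + 1) = upTime x k + downTime x k + x k := by
  by_cases h : Even k
  · rw [upTime_succ_of_even h, downTime_succ_of_even h]
    ring
  · rw [upTime_succ_of_odd h, downTime_succ_of_odd h]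
    ring

lemma mem_staysNonneg_succ :
    x ∈ staysNonneg γ (k + 1) ↔ x ∈ staysNonneg γ k ∧ 0 ≤ height γ x (k + 1) := by
  constructor
  · exact fun h => ⟨fun j hj => h j (hj.trans k.le_succ), h _ le_rfl⟩
  · rintro ⟨h, h'⟩ j hj
    rcases hj.lt_or_eq with hj | rfl
    · exact h j (Nat.lt_succ_iff.1 hj)
    · exact h'

lemma mem_staysNonneg_zero : x ∈ staysNonneg γ 0 := by
  intro j hj
  rw [Nat.le_zero.1 hj]
  simp [height]

end Sequences

section Paths

variable {γ : Fin 2 → ℝ} {p : ℝ → Fin 2} {τ : ℕ → ℝ}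

lemma IsSwitchingTimes.upTime_add_downTime (h : IsSwitchingTimes p τ) (n : ℕ) :
    upTime (fun k => τ (k + 1) - τ k) n + downTime (fun k => τ (k + 1) - τ k) n = τ n := by
  induction n with
  | zero => simp [h.zero]
  | succ n ih =>
    rw [upTime_add_downTime_succ, ih]
    ring

lemma IsSwitchingTimes.state (h : IsSwitchingTimes p τ) (h0 : p 0 = 0) (n : ℕ) :
    p (τ n) = if Even n then 0 else 1 := by
  induction n with
  | zero => simp [h.zero, h0]
  | succ n ih =>
    have := h.switch n
    rw [ih] at this
    by_cases hn : Even n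
    · simp only [hn, if_true] at this
      simp only [Nat.even_add_one, hn, not_true, if_false]
      lia
    · simp only [hn, if_false] at this
      simp only [Nat.even_add_one, hn, not_false_iff, if_true]
      lia

lemma IsSwitchingTimes.exists_mem_Ico (h : IsSwitchingTimes p τ) {u : ℝ} (hu : 0 ≤ u) :
    ∃ n, u ∈ Ico (τ n) (τ (n + 1)) := by
  classical
  have hex : ∃ n, u < τ n := (h.tendsto_atTop.eventually_gt_atTop u).exists
  have hne : Nat.find hex ≠ 0 := by
    intro h0
    have := Nat.find_spec hex
    rw [h0, h.zero] at this
    linarith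
  obtain ⟨n, hn⟩ := Nat.exists_eq_succ_of_ne_zero hne
  refine ⟨n, ?_, ?_⟩
  · exact not_lt.1 (Nat.find_min hex (by omega))
  · have := Nat.find_spec hex
    rwa [hn] at this

lemma IsSwitchingTimes.ncard_eq (h : IsSwitchingTimes p τ) {t : ℝ} {n : ℕ}
    (hn : t ∈ Ico (τ n) (τ (n + 1))) : {k : ℕ | 1 ≤ k ∧ τ k ≤ t}.ncard = n := by
  have : {k : ℕ | 1 ≤ k ∧ τ k ≤ t} = (Finset.Icc 1 n : Finset ℕ) := by
    ext k
    simp only [mem_ofPred_eq, Finset.coe_Icc, mem_Icc, and_congr_right_iff]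
    intro _
    constructor
    · intro hk
      have := h.strictMono.lt_iff_lt.1 (hk.trans_lt hn.2)
      omega
    · exact fun hk => (h.strictMono.monotone hk).trans hn.1
  rw [this, ncard_coe_finset]
  simp

lemma IsSwitchingTimes.ncard_eq_iff (h : IsSwitchingTimes p τ) {t : ℝ} (ht : 0 ≤ t) {n : ℕ} :
    {k : ℕ | 1 ≤ k ∧ τ k ≤ t}.ncard = n ↔ t ∈ Ico (τ n) (τ (n + 1)) := by
  refine ⟨?_, h.ncard_eq⟩
  rintro rfl
  obtain ⟨m, hm⟩ := h.exists_mem_Ico ht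
  rwa [h.ncard_eq hm]

lemma IsSwitchingTimes.integral_segment (h : IsSwitchingTimes p τ) (γ : Fin 2 → ℝ) (n : ℕ) {u : ℝ}
    (hu : u ∈ Icc (τ n) (τ (n + 1))) :
    IntervalIntegrable (fun s => γ (p s)) volume (τ n) u ∧
      ∫ s in (τ n)..u, γ (p s) = γ (p (τ n)) * (u - τ n) := by
  have hae : ∀ᵐ s, s ∈ Set.uIoc (τ n) u → γ (p (τ n)) = γ (p s) := by
    filter_upwards [compl_mem_ae_iff.2 (measure_singleton (τ (n + 1)))] with s hs hs'
    rw [uIoc_of_le hu.1] at hs'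
    rw [h.constant n s ⟨hs'.1.le, lt_of_le_of_ne (hs'.2.trans hu.2) hs⟩]
  constructor
  · refine (intervalIntegrable_const (c := γ (p (τ n)))).congr_ae ?_
    exact (ae_restrict_iff' measurableSet_uIoc).2 hae
  · rw [← intervalIntegral.integral_congr_ae hae]
    simp [mul_comm]

/-- Between two switchings the path is affine, starting from the last turning point. -/
lemma IsSwitchingTimes.integral_eq (h : IsSwitchingTimes p τ) (h0 : p 0 = 0) (γ : Fin 2 → ℝ)
    (n : ℕ) {u : ℝ} (hu : u ∈ Icc (τ n) (τ (n + 1))) :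
    IntervalIntegrable (fun s => γ (p s)) volume 0 u ∧
      ∫ s in (0 : ℝ)..u, γ (p s) = height γ (fun k => τ (k + 1) - τ k) n
        + γ (if Even n then 0 else 1) * (u - τ n) := by
  induction n generalizing u with
  | zero =>
    have := h.integral_segment γ 0 hu
    rw [h.zero] at this
    simpa [height, h0, h.zero] using this
  | succ n ih =>
    obtain ⟨i1, e1⟩ := ih (right_mem_Icc.2 (h.strictMono.monotone n.le_succ))
    obtain ⟨i2, e2⟩ := h.integral_segment γ (n + 1) hu
    refine ⟨i1.trans i2, ?_⟩
    rw [← intervalIntegral.integral_add_adjacent_intervals i1 i2, e1, e2, h.state h0, height_succ]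

/-- The path stays nonnegative on `[0, t]` if it is nonnegative at the turning points and at `t`,
being affine in between. -/
lemma IsSwitchingTimes.nonneg_iff (h : IsSwitchingTimes p τ) (h0 : p 0 = 0) (γ : Fin 2 → ℝ)
    {t : ℝ} {n : ℕ} (hn : t ∈ Ico (τ n) (τ (n + 1))) :
    (∀ u ∈ Icc 0 t, 0 ≤ ∫ s in (0 : ℝ)..u, γ (p s)) ↔
      (fun k => τ (k + 1) - τ k) ∈ staysNonneg γ n ∧ 0 ≤ ∫ s in (0 : ℝ)..t, γ (p s) := by
  have hτ : ∀ n, 0 ≤ τ n := fun n => h.zero ▸ h.strictMono.monotone n.zero_le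
  have hht : ∀ j, ∫ s in (0 : ℝ)..τ j, γ (p s) = height γ (fun k => τ (k + 1) - τ k) j := by
    intro j
    rw [(h.integral_eq h0 γ j (left_mem_Icc.2 (h.strictMono.monotone j.le_succ))).2]
    simp
  constructor
  · intro H
    refine ⟨fun j hj => ?_, H t ⟨(hτ n).trans hn.1, le_rfl⟩⟩
    rw [← hht]
    exact H _ ⟨hτ j, (h.strictMono.monotone hj).trans hn.1⟩
  · rintro ⟨H, Ht⟩ u hu
    obtain ⟨j, hj⟩ := h.exists_mem_Ico hu.1
    have hjn : j ≤ n := by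
      have := h.strictMono.lt_iff_lt.1 ((hj.1.trans hu.2).trans_lt hn.2)
      omega
    -- an affine function which is nonnegative at both ends of `[τ j, b]` is nonnegative at `u`
    have key : ∀ b, u ≤ b → b ≤ τ (j + 1) → 0 ≤ ∫ s in (0 : ℝ)..b, γ (p s) →
        0 ≤ ∫ s in (0 : ℝ)..u, γ (p s) := by
      intro b hub hb Hb
      rw [(h.integral_eq h0 γ j ⟨hj.1.trans hub, hb⟩).2] at Hb
      rw [(h.integral_eq h0 γ j ⟨hj.1, hj.2.le⟩).2]
      have Hj := H j hjn
      have hju := hj.1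
      rcases le_total 0 (γ (if Even j then 0 else 1)) with hs | hs
      · nlinarith
      · nlinarith
    rcases hjn.lt_or_eq with hlt | rfl
    · refine key (τ (j + 1)) hj.2.le le_rfl ?_
      rw [hht]
      exact H _ hlt
    · exact key t hu.2 hn.2.le Ht

end Paths

variable {Ω : Type*}

lemma bddBelow_position (γ : Fin 2 → ℝ) (ε : ℝ → Ω → Fin 2) (t : ℝ) (ω : Ω) :
    BddBelow ((fun u => position γ ε u ω) '' Icc 0 t) := by
  refine ⟨-(max |γ 0| |γ 1| * t), ?_⟩
  rintro _ ⟨u, hu, rfl⟩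
  have h : ‖position γ ε u ω‖ ≤ max |γ 0| |γ 1| * |u - 0| := by
    refine intervalIntegral.norm_integral_le_of_norm_le_const fun s _ => ?_
    rw [Real.norm_eq_abs]
    generalize ε s ω = i
    fin_cases i
    · exact le_max_left _ _
    · exact le_max_right _ _
  rw [sub_zero, abs_of_nonneg hu.1, Real.norm_eq_abs] at h
  have h1 := neg_abs_le (position γ ε u ω)
  have h2 : max |γ 0| |γ 1| * u ≤ max |γ 0| |γ 1| * t :=
    mul_le_mul_of_nonneg_left hu.2 ((abs_nonneg _).trans (le_max_left _ _))
  simp only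
  linarith

lemma runMin_eq_zero_iff (γ : Fin 2 → ℝ) (ε : ℝ → Ω → Fin 2) {t : ℝ} (ht : 0 ≤ t) (ω : Ω) :
    runMin γ ε t ω = 0 ↔ ∀ u ∈ Icc 0 t, 0 ≤ position γ ε u ω := by
  constructor
  · intro h u hu
    rw [← h]
    exact csInf_le (bddBelow_position γ ε t ω) (mem_image_of_mem _ hu)
  · intro h
    refine IsLeast.csInf_eq ⟨⟨0, left_mem_Icc.2 ht, by simp [position]⟩, ?_⟩
    rintro _ ⟨u, hu, rfl⟩
    exact h u hu

/-- The position at time `t` of a path that has switched exactly `n` times: the current sojourn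
lasts for what remains of `[0, t]`, so the time spent in the other state determines the position. -/
noncomputable def endpoint (γ : Fin 2 → ℝ) (t : ℝ) (n : ℕ) (x : ℕ → ℝ) : ℝ :=
  if Even n then γ 0 * (t - downTime x n) + γ 1 * downTime x n
  else γ 0 * upTime x n + γ 1 * (t - upTime x n)

lemma height_add_eq_endpoint (γ : Fin 2 → ℝ) (t : ℝ) (n : ℕ) (x : ℕ → ℝ) :
    height γ x n + γ (if Even n then 0 else 1) * (t - (upTime x n + downTime x n))
      = endpoint γ t n x := by
  unfold endpoint height
  split_ifs <;> ring

/-- The event of the positive meander, in terms of the holding times. -/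
def meanderSet (γ : Fin 2 → ℝ) (t : ℝ) (B : Set ℝ) (n : ℕ) : Set (ℕ → ℝ) :=
  {x | x ∈ staysNonneg γ n ∧ upTime x n + downTime x n ≤ t ∧ t < upTime x n + downTime x n + x n ∧
    endpoint γ t n x ∈ B ∩ Ici 0}

lemma mem_posMeander_iff {γ : Fin 2 → ℝ} {ε : ℝ → Ω → Fin 2} {τ : ℕ → Ω → ℝ} {ω : Ω}
    (h : IsSwitchingTimes (fun s => ε s ω) (fun n => τ n ω)) (h0 : ε 0 ω = 0) {t : ℝ} (ht : 0 ≤ t)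
    (B : Set ℝ) (n : ℕ) :
    ω ∈ posMeander γ ε τ t B n ↔ (fun k => τ (k + 1) ω - τ k ω) ∈ meanderSet γ t B n := by
  have hsum := h.upTime_add_downTime n
  have hN : numSwitches τ t ω = n ↔ t ∈ Ico (τ n ω) (τ (n + 1) ω) := h.ncard_eq_iff ht
  simp only [posMeander, meanderSet, mem_ofPred_eq, runMin_eq_zero_iff γ ε ht, hN, hsum,
    add_sub_cancel]
  by_cases hn : t ∈ Ico (τ n ω) (τ (n + 1) ω)
  · have hpos : position γ ε t ω = endpoint γ t n (fun k => τ (k + 1) ω - τ k ω) := by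
      rw [← height_add_eq_endpoint, hsum]
      exact (h.integral_eq h0 γ n ⟨hn.1, hn.2.le⟩).2
    have := h.nonneg_iff h0 γ hn
    simp only [position] at hpos ⊢
    rw [this, hpos]
    simp only [mem_Ico] at hn
    simp only [hn, mem_Ico, mem_inter_iff, mem_Ici]
    tauto
  · simp only [hn, and_false, false_iff]
    rintro ⟨-, h1, h2, -⟩
    exact hn ⟨h1, h2⟩

end

/-! ### The ballot polynomials -/

section

/-- With `r` the ratio of the downward to the upward speed, `evenPoly r n u d` is the volume of the
set of `n + 1` upward and `n + 1` downward alternating sojourn lengths with sums `u` and `d` along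
which the path stays nonnegative. -/
noncomputable def evenPoly (r : ℝ) (n : ℕ) (u d : ℝ) : ℝ :=
  u ^ n * d ^ n / (n ! : ℝ) ^ 2
    - r * (n * u ^ (n - 1)) * d ^ (n + 1) / ((n ! : ℝ) * ((n + 1)! : ℝ))

/-- The analogue of `evenPoly` for `n + 2` upward and `n + 1` downward sojourns. -/
noncomputable def oddPoly (r : ℝ) (n : ℕ) (u d : ℝ) : ℝ :=
  u ^ n * d ^ n * (u - r * d) / ((n ! : ℝ) * ((n + 1)! : ℝ))

@[fun_prop]
lemma continuous_evenPoly (r : ℝ) (n : ℕ) : Continuous fun p : ℝ × ℝ => evenPoly r n p.1 p.2 := by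
  unfold evenPoly
  fun_prop

@[fun_prop]
lemma continuous_oddPoly (r : ℝ) (n : ℕ) : Continuous fun p : ℝ × ℝ => oddPoly r n p.1 p.2 := by
  unfold oddPoly
  fun_prop

lemma evenPoly_zero (r u d : ℝ) : evenPoly r 0 u d = 1 := by simp [evenPoly]

lemma oddPoly_nonneg {r u d : ℝ} (hr : 0 < r) (n : ℕ) (hd : 0 ≤ d) (hu : r * d ≤ u) :
    0 ≤ oddPoly r n u d := by
  have hu0 : 0 ≤ u := (mul_nonneg hr.le hd).trans hu
  have : 0 ≤ u - r * d := sub_nonneg.2 hu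
  unfold oddPoly
  positivity

lemma hasDerivAt_oddPoly (r : ℝ) (n : ℕ) (u d : ℝ) :
    HasDerivAt (fun u => oddPoly r n u d) (evenPoly r n u d) u := by
  have h := (((hasDerivAt_pow n u).mul_const (d ^ n)).mul
    ((hasDerivAt_id u).sub_const (r * d))).div_const ((n ! : ℝ) * ((n + 1)! : ℝ))
  refine h.congr_deriv ?_
  have h1 : ((n + 1)! : ℝ) = (n + 1) * n ! := by
    rw [Nat.factorial_succ]
    push_cast
    ring
  have hn : (n ! : ℝ) ≠ 0 := by positivity
  have hn1 : (n + 1 : ℝ) ≠ 0 := by positivity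
  have hpow : (n : ℝ) * u ^ (n - 1) * u = n * u ^ n := by
    rcases n with _ | n
    · simp
    · rw [Nat.add_sub_cancel, mul_assoc, ← pow_succ]
  simp only [id, evenPoly, h1]
  field_simp
  linear_combination d ^ n * hpow

lemma hasDerivAt_evenPoly (r : ℝ) (n : ℕ) (u d : ℝ) :
    HasDerivAt (fun d => evenPoly r (n + 1) u d) (oddPoly r n u d) d := by
  have h := (((hasDerivAt_pow (n + 1) d).const_mul (u ^ (n + 1))).div_const
      (((n + 1)! : ℝ) ^ 2)).sub
    (((hasDerivAt_pow (n + 1 + 1) d).const_mul (r * ((n + 1 : ℕ) * u ^ (n + 1 - 1)))).div_const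
      (((n + 1)! : ℝ) * ((n + 1 + 1)! : ℝ)))
  refine h.congr_deriv ?_
  have h1 : ((n + 1)! : ℝ) = (n + 1) * n ! := by
    rw [Nat.factorial_succ]
    push_cast
    ring
  have h2 : ((n + 1 + 1)! : ℝ) = (n + 2) * ((n + 1) * n !) := by
    rw [Nat.factorial_succ, Nat.factorial_succ]
    push_cast
    ring
  have hn : (n ! : ℝ) ≠ 0 := by positivity
  have hn1 : (n + 1 : ℝ) ≠ 0 := by positivity
  have hn2 : (n + 2 : ℝ) ≠ 0 := by positivity
  simp only [oddPoly, h1, h2, Nat.add_sub_cancel]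
  push_cast
  field_simp
  ring

lemma setLIntegral_oddPoly {r u d : ℝ} (hr : 0 < r) (n : ℕ) (hd : 0 ≤ d) (hu : r * d ≤ u) :
    ∫⁻ e in Icc 0 d, ENNReal.ofReal (oddPoly r n u e)
      = ENNReal.ofReal (evenPoly r (n + 1) u d) := by
  have hc : Continuous fun e => oddPoly r n u e :=
    (continuous_oddPoly r n).comp (by fun_prop : Continuous fun e : ℝ => (u, e))
  have h0 : evenPoly r (n + 1) u 0 = 0 := by simp [evenPoly]
  rw [← ofReal_integral_eq_lintegral_ofReal hc.continuousOn.integrableOn_Icc,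
    integral_Icc_eq_integral_Ioc, ← intervalIntegral.integral_of_le hd,
    intervalIntegral.integral_eq_sub_of_hasDerivAt (fun e _ => hasDerivAt_evenPoly r n u e)
      (hc.intervalIntegrable _ _), h0, sub_zero]
  refine (ae_restrict_iff' measurableSet_Icc).2 (ae_of_all _ fun e he => ?_)
  exact oddPoly_nonneg hr n he.1 ((mul_le_mul_of_nonneg_left he.2 hr.le).trans hu)

/-- `evenPoly` is nonnegative as a primitive, in `d`, of the nonnegative `oddPoly`. -/
lemma evenPoly_nonneg {r u d : ℝ} (hr : 0 < r) (n : ℕ) (hd : 0 ≤ d) (hu : r * d ≤ u) :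
    0 ≤ evenPoly r n u d := by
  rcases n with _ | n
  · simp [evenPoly_zero]
  have h0 : evenPoly r (n + 1) u 0 = 0 := by simp [evenPoly]
  rw [← h0]
  have hc : Continuous fun e => evenPoly r (n + 1) u e :=
    (continuous_evenPoly r (n + 1)).comp (by fun_prop : Continuous fun e : ℝ => (u, e))
  refine monotoneOn_of_deriv_nonneg (convex_Icc 0 d) hc.continuousOn
    (fun e _ => (hasDerivAt_evenPoly r n u e).differentiableAt.differentiableWithinAt)
    (fun e he => ?_) (left_mem_Icc.2 hd) (right_mem_Icc.2 hd) hd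
  rw [interior_Icc] at he
  rw [(hasDerivAt_evenPoly r n u e).deriv]
  exact oddPoly_nonneg hr n he.1.le ((mul_le_mul_of_nonneg_left he.2.le hr.le).trans hu)

lemma setLIntegral_evenPoly {r u d : ℝ} (hr : 0 < r) (n : ℕ) (hd : 0 ≤ d) (hu : r * d ≤ u) :
    ∫⁻ a in Icc (r * d) u, ENNReal.ofReal (evenPoly r n a d)
      = ENNReal.ofReal (oddPoly r n u d) := by
  have hc : Continuous fun a => evenPoly r n a d :=
    (continuous_evenPoly r n).comp (by fun_prop : Continuous fun a : ℝ => (a, d))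
  have h0 : oddPoly r n (r * d) d = 0 := by simp [oddPoly]
  rw [← ofReal_integral_eq_lintegral_ofReal hc.continuousOn.integrableOn_Icc,
    integral_Icc_eq_integral_Ioc, ← intervalIntegral.integral_of_le hu,
    intervalIntegral.integral_eq_sub_of_hasDerivAt (fun a _ => hasDerivAt_oddPoly r n a d)
      (hc.intervalIntegrable _ _), h0, sub_zero]
  refine (ae_restrict_iff' measurableSet_Icc).2 (ae_of_all _ fun a ha => ?_)
  exact evenPoly_nonneg hr n hd ha.1

/-- The pairs of an upward and a downward time for which the path ends at a nonnegative height. -/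
def cone (γ : Fin 2 → ℝ) : Set (ℝ × ℝ) := {p | 0 ≤ p.2 ∧ 0 ≤ γ 0 * p.1 + γ 1 * p.2}

lemma measurableSet_cone (γ : Fin 2 → ℝ) : MeasurableSet (cone γ) := by
  have h : Measurable fun p : ℝ × ℝ => γ 0 * p.1 + γ 1 * p.2 := by fun_prop
  exact (measurableSet_le measurable_const measurable_snd).inter
    (measurableSet_le measurable_const h)

lemma ratio_mul_le_iff {γ : Fin 2 → ℝ} (hγ0 : 0 < γ 0) (u d : ℝ) :
    -γ 1 / γ 0 * d ≤ u ↔ 0 ≤ γ 0 * u + γ 1 * d := by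
  rw [div_mul_eq_mul_div, div_le_iff₀ hγ0]
  constructor <;> intro h <;> linarith

lemma setLIntegral_cone_evenPoly {γ : Fin 2 → ℝ} (hγ0 : 0 < γ 0) (hγ1 : γ 1 < 0) (n : ℕ) {u d : ℝ}
    (h : 0 ≤ γ 0 * u + γ 1 * d) :
    ∫⁻ a in Iic u, (cone γ).indicator
        (fun p => ENNReal.ofReal (evenPoly (-γ 1 / γ 0) n p.1 p.2)) (a, d)
      = if 0 ≤ d then ENNReal.ofReal (oddPoly (-γ 1 / γ 0) n u d) else 0 := by
  have hr : 0 < -γ 1 / γ 0 := div_pos (neg_pos.2 hγ1) hγ0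
  split_ifs with hd
  · rw [← setLIntegral_evenPoly hr n hd ((ratio_mul_le_iff hγ0 u d).2 h),
      ← lintegral_indicator measurableSet_Iic, ← lintegral_indicator measurableSet_Icc]
    refine lintegral_congr fun a => ?_
    simp only [indicator, mem_Iic, mem_Icc, cone, mem_ofPred_eq, hd, true_and,
      ← ratio_mul_le_iff hγ0]
    split_ifs <;> simp_all
  · rw [← lintegral_zero]
    refine lintegral_congr fun a => indicator_of_notMem (fun ha => hd ha.1) _

lemma setLIntegral_cone_oddPoly {γ : Fin 2 → ℝ} (hγ0 : 0 < γ 0) (hγ1 : γ 1 < 0) (n : ℕ) {u d : ℝ}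
    (h : 0 ≤ γ 0 * u + γ 1 * d) :
    ∫⁻ e in Iic d, (cone γ).indicator
        (fun p => ENNReal.ofReal (oddPoly (-γ 1 / γ 0) n p.1 p.2)) (u, e)
      = if 0 ≤ d then ENNReal.ofReal (evenPoly (-γ 1 / γ 0) (n + 1) u d) else 0 := by
  have hr : 0 < -γ 1 / γ 0 := div_pos (neg_pos.2 hγ1) hγ0
  split_ifs with hd
  · rw [← setLIntegral_oddPoly hr n hd ((ratio_mul_le_iff hγ0 u d).2 h),
      ← lintegral_indicator measurableSet_Iic, ← lintegral_indicator measurableSet_Icc]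
    refine lintegral_congr fun e => ?_
    by_cases he : e ≤ d
    · have : 0 ≤ γ 0 * u + γ 1 * e := by nlinarith
      simp [indicator, cone, he, this]
    · simp [indicator, he]
  · rw [← lintegral_zero (μ := volume.restrict (Iic d))]
    refine setLIntegral_congr_fun measurableSet_Iic fun e he => ?_
    exact indicator_of_notMem (fun ha => hd (ha.1.trans he)) _

end

/-! ### The law of the two occupation times -/

section

lemma measurable_upTime (k : ℕ) : Measurable fun x : ℕ → ℝ => upTime x k := by
  unfold upTime
  refine Finset.measurable_fun_sum _ fun j _ => ?_
  split_ifs <;> fun_prop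

lemma measurable_downTime (k : ℕ) : Measurable fun x : ℕ → ℝ => downTime x k := by
  unfold downTime
  refine Finset.measurable_fun_sum _ fun j _ => ?_
  split_ifs <;> fun_prop

lemma measurable_height (γ : Fin 2 → ℝ) (k : ℕ) : Measurable fun x : ℕ → ℝ => height γ x k :=
  ((measurable_upTime k).const_mul _).add ((measurable_downTime k).const_mul _)

lemma measurableSet_staysNonneg (γ : Fin 2 → ℝ) (k : ℕ) : MeasurableSet (staysNonneg γ k) := by
  have : staysNonneg γ k = ⋂ j, ⋂ (_ : j ≤ k), {x | 0 ≤ height γ x j} := by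
    ext x
    simp [staysNonneg]
  rw [this]
  exact MeasurableSet.iInter fun j => MeasurableSet.iInter fun _ =>
    measurableSet_le measurable_const (measurable_height γ j)

lemma measurable_endpoint (γ : Fin 2 → ℝ) (t : ℝ) (k : ℕ) :
    Measurable (endpoint γ t k) := by
  have h1 := measurable_upTime k
  have h2 := measurable_downTime k
  unfold endpoint
  split_ifs <;> fun_prop

lemma measurableSet_meanderSet (γ : Fin 2 → ℝ) (t : ℝ) {B : Set ℝ} (hB : MeasurableSet B) (k : ℕ) :
    MeasurableSet (meanderSet γ t B k) := by
  have h1 := measurable_upTime k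
  have h2 := measurable_downTime k
  refine (measurableSet_staysNonneg γ k).inter ((measurableSet_le (h1.add h2)
    measurable_const).inter ((measurableSet_lt measurable_const
      ((h1.add h2).add (measurable_pi_apply k))).inter ?_))
  exact measurable_endpoint γ t k (hB.inter measurableSet_Ici)

lemma indicator_one_congr {α β : Type*} {s : Set α} {t : Set β} {a : α} {b : β}
    (h : a ∈ s ↔ b ∈ t) : s.indicator (1 : α → ℝ≥0∞) a = t.indicator 1 b := by
  by_cases hb : b ∈ t <;> simp [indicator, h, hb]

lemma indicator_one_eq_mul {α β δ : Type*} {s : Set α} {t : Set β} {u : Set δ} {a : α} {b : β}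
    {c : δ} (h : a ∈ s ↔ b ∈ t ∧ c ∈ u) :
    s.indicator (1 : α → ℝ≥0∞) a = t.indicator 1 b * u.indicator 1 c := by
  by_cases hb : b ∈ t <;> by_cases hc : c ∈ u <;> simp [indicator, h, hb, hc]

section Congr

variable {γ : Fin 2 → ℝ} {x y : ℕ → ℝ} {k : ℕ}

lemma upTime_congr (h : ∀ j < k, x j = y j) : upTime x k = upTime y k :=
  Finset.sum_congr rfl fun j hj => by rw [h j (Finset.mem_range.1 hj)]

lemma downTime_congr (h : ∀ j < k, x j = y j) : downTime x k = downTime y k :=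
  Finset.sum_congr rfl fun j hj => by rw [h j (Finset.mem_range.1 hj)]

lemma staysNonneg_indicator_congr (h : ∀ j < k, x j = y j) :
    (staysNonneg γ k).indicator (1 : (ℕ → ℝ) → ℝ≥0∞) x = (staysNonneg γ k).indicator 1 y := by
  refine indicator_one_congr (forall₂_congr fun j hj => ?_)
  rw [height, height, upTime_congr fun i hi => h i (hi.trans_le hj),
    downTime_congr fun i hi => h i (hi.trans_le hj)]

end Congr

/-- The indicator of the event that the turning points up to the `k`-th one are nonnegative. -/
noncomputable def weight {Ω : Type*} (γ : Fin 2 → ℝ) (X : ℕ → Ω → ℝ) (k : ℕ) (ω : Ω) : ℝ≥0∞ :=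
  (staysNonneg γ k).indicator 1 (fun n => X n ω)

lemma weight_succ_mul {Ω : Type*} (γ : Fin 2 → ℝ) (X : ℕ → Ω → ℝ) (k : ℕ) (ω : Ω) (c : ℝ≥0∞) :
    weight γ X (k + 1) ω * c
      = weight γ X k ω * if 0 ≤ height γ (fun n => X n ω) (k + 1) then c else 0 := by
  unfold weight
  by_cases h : (fun n => X n ω) ∈ staysNonneg γ k
  · by_cases h' : 0 ≤ height γ (fun n => X n ω) (k + 1)
    · rw [indicator_of_mem (mem_staysNonneg_succ.2 ⟨h, h'⟩), indicator_of_mem h, if_pos h']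
    · rw [indicator_of_notMem fun hx => h' (mem_staysNonneg_succ.1 hx).2, if_neg h', zero_mul,
        mul_zero]
  · rw [indicator_of_notMem fun hx => h (mem_staysNonneg_succ.1 hx).1, indicator_of_notMem h,
      zero_mul, zero_mul]

/-- The holding times of the process started in state `0`: independent, exponentially distributed,
with the rates `lam 0, lam 1, lam 0, …`. -/
structure IsHoldingSequence {Ω : Type*} [MeasurableSpace Ω] (Q : Measure Ω) (lam : Fin 2 → ℝ)
    (X : ℕ → Ω → ℝ) : Prop where
  measurable : ∀ n, Measurable (X n)
  indep : iIndepFun X Q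
  law : ∀ n, Q.map (X n) = expMeasure (lam (if Even n then 0 else 1))

variable {Ω : Type*} [MeasurableSpace Ω] {Q : Measure Ω} {lam : Fin 2 → ℝ} {X : ℕ → Ω → ℝ}

lemma IsHoldingSequence.measurable_pi (hX : IsHoldingSequence Q lam X) :
    Measurable fun ω n => X n ω := measurable_pi_lambda _ hX.measurable

/-- A function of the first `k` holding times is independent of the next one. -/
lemma IsHoldingSequence.indepFun_past (hX : IsHoldingSequence Q lam X) {β : Type*}
    [MeasurableSpace β] {f : (ℕ → ℝ) → β} (hf : Measurable f) {k : ℕ}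
    (hfk : ∀ x y : ℕ → ℝ, (∀ j < k, x j = y j) → f x = f y) :
    IndepFun (fun ω => f fun n => X n ω) (X k) Q := by
  have h := hX.indep.indepFun_finset (Finset.range k) {k} (by simp) hX.measurable
  set g : (Finset.range k → ℝ) → (ℕ → ℝ) := fun y j =>
    if h : j ∈ Finset.range k then y ⟨j, h⟩ else 0
    with hg
  have hgm : Measurable g := by
    refine measurable_pi_lambda _ fun j => ?_
    by_cases hj : j ∈ Finset.range k
    · simp only [hg, hj, dif_pos]
      fun_prop
    · simp only [hg, hj, dif_neg, not_false_iff]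
      fun_prop
  have := h.comp (hf.comp hgm)
    (by fun_prop : Measurable fun y : ({k} : Finset ℕ) → ℝ => y ⟨k, Finset.mem_singleton_self k⟩)
  convert this using 1
  · funext ω
    refine hfk _ _ fun j hj => ?_
    simp [hg, hj]
  · rfl

lemma IsHoldingSequence.measurable_weight (hX : IsHoldingSequence Q lam X) (γ : Fin 2 → ℝ) (k : ℕ) :
    Measurable (weight γ X k) :=
  (measurable_one.indicator (measurableSet_staysNonneg γ k)).comp hX.measurable_pi

lemma IsHoldingSequence.indepFun_up (hX : IsHoldingSequence Q lam X) (γ : Fin 2 → ℝ) (k : ℕ) :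
    IndepFun (fun ω => (upTime (fun n => X n ω) k, downTime (fun n => X n ω) k, weight γ X k ω))
      (X k) Q := by
  refine hX.indepFun_past (f := fun x => (upTime x k, downTime x k,
    (staysNonneg γ k).indicator (1 : (ℕ → ℝ) → ℝ≥0∞) x)) ?_ fun x y h => ?_
  · exact (measurable_upTime k).prodMk ((measurable_downTime k).prodMk
      (measurable_one.indicator (measurableSet_staysNonneg γ k)))
  · rw [upTime_congr h, downTime_congr h, staysNonneg_indicator_congr h]

lemma IsHoldingSequence.indepFun_down (hX : IsHoldingSequence Q lam X) (γ : Fin 2 → ℝ) (k : ℕ) :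
    IndepFun (fun ω => (downTime (fun n => X n ω) k, upTime (fun n => X n ω) k, weight γ X k ω))
      (X k) Q :=
  (hX.indepFun_up γ k).comp
    (by fun_prop : Measurable fun p : ℝ × ℝ × ℝ≥0∞ => (p.2.1, p.1, p.2.2)) measurable_id

lemma measurable_ite_height {γ : Fin 2 → ℝ} {F : ℝ → ℝ → ℝ≥0∞}
    (hF : Measurable (Function.uncurry F)) :
    Measurable (Function.uncurry fun a b => if 0 ≤ γ 0 * a + γ 1 * b then F a b else 0) := by
  have h : Measurable fun p : ℝ × ℝ => γ 0 * p.1 + γ 1 * p.2 := by fun_prop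
  exact Measurable.ite (measurableSet_le measurable_const h) hF measurable_const

/-- The law of the two occupation times after `2 n + 1` sojourns, on the event that the path has
stayed nonnegative. For `n = 0` the downward time vanishes, hence the unspecified reference
measure `ν`; only the integrals of the density `K` over half-lines matter afterwards. -/
def OddLaw (Q : Measure Ω) (lam γ : Fin 2 → ℝ) (X : ℕ → Ω → ℝ) (n : ℕ) : Prop :=
  ∃ (ν : Measure ℝ) (K : ℝ → ℝ → ℝ≥0∞), SFinite ν ∧ Measurable (Function.uncurry K) ∧
    (∀ F : ℝ → ℝ → ℝ≥0∞, Measurable (Function.uncurry F) →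
      ∫⁻ ω, weight γ X (2 * n + 1) ω * F (downTime (fun j => X j ω) (2 * n + 1))
          (upTime (fun j => X j ω) (2 * n + 1)) ∂Q
        = ∫⁻ u, ∫⁻ d, ENNReal.ofReal (exp (-lam 1 * d - lam 0 * u)) * K d u * F d u ∂ν) ∧
    ∀ u d, 0 ≤ γ 0 * u + γ 1 * d → ∫⁻ e in Iic d, K e u ∂ν
      = ENNReal.ofReal (lam 0 ^ (n + 1) * lam 1 ^ n)
        * if 0 ≤ d then ENNReal.ofReal (evenPoly (-γ 1 / γ 0) n u d) else 0

/-- The law of the two occupation times after `2 n + 2` sojourns, on the event that the path has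
stayed nonnegative. -/
def EvenLaw (Q : Measure Ω) (lam γ : Fin 2 → ℝ) (X : ℕ → Ω → ℝ) (n : ℕ) : Prop :=
  ∀ F : ℝ → ℝ → ℝ≥0∞, Measurable (Function.uncurry F) →
    ∫⁻ ω, weight γ X (2 * n + 2) ω * F (upTime (fun j => X j ω) (2 * n + 2))
        (downTime (fun j => X j ω) (2 * n + 2)) ∂Q
      = ∫⁻ d, ∫⁻ u, ENNReal.ofReal (exp (-lam 0 * u - lam 1 * d))
          * (ENNReal.ofReal (lam 0 ^ (n + 1) * lam 1 ^ (n + 1))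
            * (cone γ).indicator
              (fun p => ENNReal.ofReal (evenPoly (-γ 1 / γ 0) n p.1 p.2)) (u, d)) * F u d

lemma measurable_evenKernel (γ : Fin 2 → ℝ) (c : ℝ≥0∞) (r : ℝ) (n : ℕ) :
    Measurable (Function.uncurry fun u d => c * (cone γ).indicator
      (fun p => ENNReal.ofReal (evenPoly r n p.1 p.2)) (u, d)) :=
  (((continuous_evenPoly r n).measurable.ennreal_ofReal).indicator
    (measurableSet_cone γ)).const_mul c

lemma measurable_evenKernel_left (γ : Fin 2 → ℝ) (r : ℝ) (n : ℕ) (d : ℝ) :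
    Measurable fun u => (cone γ).indicator
      (fun p => ENNReal.ofReal (evenPoly r n p.1 p.2)) (u, d) :=
  (((continuous_evenPoly r n).measurable.ennreal_ofReal).indicator
    (measurableSet_cone γ)).comp (measurable_id.prodMk measurable_const)

lemma measurable_oddKernel_right (γ : Fin 2 → ℝ) (r : ℝ) (n : ℕ) (u : ℝ) :
    Measurable fun d => (cone γ).indicator
      (fun p => ENNReal.ofReal (oddPoly r n p.1 p.2)) (u, d) :=
  (((continuous_oddPoly r n).measurable.ennreal_ofReal).indicator
    (measurableSet_cone γ)).comp (measurable_const.prodMk measurable_id)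

lemma measurable_oddKernel (γ : Fin 2 → ℝ) (c : ℝ≥0∞) (r : ℝ) (n : ℕ) :
    Measurable (Function.uncurry fun d u => c * (cone γ).indicator
      (fun p => ENNReal.ofReal (oddPoly r n p.1 p.2)) (u, d)) :=
  ((((continuous_oddPoly r n).measurable.ennreal_ofReal).indicator
    (measurableSet_cone γ)).const_mul c).comp measurable_swap

section Laws

variable {γ : Fin 2 → ℝ}

lemma IsHoldingSequence.oddLaw_zero (hX : IsHoldingSequence Q lam X) (hlam : ∀ i, 0 < lam i)
    (hγ0 : 0 < γ 0) (hγ1 : γ 1 < 0) : OddLaw Q lam γ X 0 := by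
  refine ⟨Measure.dirac 0, fun _ u => if 0 ≤ u then ENNReal.ofReal (lam 0) else 0,
    inferInstance, ?_, fun F hF => ?_, fun u d hud => ?_⟩
  · exact (Measurable.ite (measurableSet_le measurable_const measurable_id) measurable_const
      measurable_const).comp measurable_snd
  · have hF0 : Measurable fun u => F 0 u := hF.comp (measurable_const.prodMk measurable_id)
    have hG : Measurable fun u : ℝ => if 0 ≤ u then F 0 u else 0 :=
      Measurable.ite (measurableSet_le measurable_const measurable_id) hF0 measurable_const
    have h1 : ∀ ω, weight γ X 1 ω * F (downTime (fun j => X j ω) 1) (upTime (fun j => X j ω) 1)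
        = if 0 ≤ X 0 ω then F 0 (X 0 ω) else 0 := by
      intro ω
      have hu : upTime (fun j => X j ω) 1 = X 0 ω := by simp [upTime]
      have hd : downTime (fun j => X j ω) 1 = 0 := by simp [downTime]
      rw [weight_succ_mul, height, zero_add, hu, hd]
      simp [weight, mem_staysNonneg_zero, hγ0]
    simp only [mul_zero, zero_add, h1]
    calc ∫⁻ ω, (if 0 ≤ X 0 ω then F 0 (X 0 ω) else 0) ∂Q
        = ∫⁻ u, (if 0 ≤ u then F 0 u else 0) ∂(Q.map (X 0)) := by
          rw [lintegral_map hG (hX.measurable 0)]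
      _ = _ := by
          rw [hX.law 0, expMeasure_eq_withDensity,
            lintegral_withDensity_eq_lintegral_mul _ (measurable_exponentialPDF _) hG]
          refine lintegral_congr fun u => ?_
          rw [lintegral_dirac]
          by_cases hu : 0 ≤ u
          · simp only [Pi.mul_apply, exponentialPDF_of_nonneg hu, hu, if_true, Even.zero,
              ENNReal.ofReal_mul (hlam 0).le]
            ring_nf
          · simp [hu]
  · rw [lintegral_const, Measure.restrict_apply_univ, evenPoly_zero]
    by_cases hd : 0 ≤ d
    · have hu : 0 ≤ u := by
        by_contra hu
        nlinarith
      simp [hu, hd]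
    · simp [hd]

lemma IsHoldingSequence.evenLaw_of_oddLaw [IsProbabilityMeasure Q] (hX : IsHoldingSequence Q lam X)
    (hlam : ∀ i, 0 < lam i) {n : ℕ} (h : OddLaw Q lam γ X n) : EvenLaw Q lam γ X n := by
  obtain ⟨ν, K, hν, hK, hlaw, hint⟩ := h
  intro F hF
  have hk : ¬Even (2 * n + 1) := by simp
  have hl := hX.law (2 * n + 1)
  rw [if_neg hk] at hl
  have hF' : Measurable (Function.uncurry fun d u => if 0 ≤ γ 0 * u + γ 1 * d then F u d else 0) :=
    (measurable_ite_height (γ := γ) hF).comp measurable_swap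
  have key := lintegral_add_exponential ((measurable_downTime _).comp hX.measurable_pi)
    ((measurable_upTime _).comp hX.measurable_pi) (hX.measurable (2 * n + 1))
    (hX.measurable_weight γ _) (hX.indepFun_down γ (2 * n + 1)) (hlam 1) hl hK hlaw hF'
  have hm := measurable_evenKernel γ
    (ENNReal.ofReal (lam 0 ^ (n + 1) * lam 1 ^ (n + 1))) (-γ 1 / γ 0) n
  have hm' : Measurable (Function.uncurry fun d u =>
      ENNReal.ofReal (exp (-lam 0 * u - lam 1 * d))
        * (ENNReal.ofReal (lam 0 ^ (n + 1) * lam 1 ^ (n + 1)) * (cone γ).indicator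
          (fun p => ENNReal.ofReal (evenPoly (-γ 1 / γ 0) n p.1 p.2)) (u, d)) * F u d) :=
    ((by fun_prop : Measurable fun p : ℝ × ℝ =>
      ENNReal.ofReal (exp (-lam 0 * p.2 - lam 1 * p.1))).mul (hm.comp measurable_swap)).mul
        (hF.comp measurable_swap)
  rw [lintegral_lintegral_swap hm'.aemeasurable]
  calc _ = _ := lintegral_congr fun ω => by
        rw [show 2 * n + 2 = 2 * n + 1 + 1 from rfl, weight_succ_mul, height,
          downTime_succ_of_odd hk, upTime_succ_of_odd hk]
        rfl
    _ = _ := key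
    _ = _ := by
        refine lintegral_congr fun u => lintegral_congr fun d => ?_
        by_cases hud : 0 ≤ γ 0 * u + γ 1 * d
        · rw [hint u d hud, if_pos hud, pow_succ (lam 1), ← mul_assoc (lam 0 ^ (n + 1)),
            mul_comm _ (lam 1), ENNReal.ofReal_mul (hlam 1).le,
            ← mul_assoc (ENNReal.ofReal (lam 1)),
            show -lam 1 * d - lam 0 * u = -lam 0 * u - lam 1 * d by ring]
          simp [indicator, cone, hud]
        · simp [indicator, cone, hud]

lemma IsHoldingSequence.oddLaw_succ_of_evenLaw [IsProbabilityMeasure Q]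
    (hX : IsHoldingSequence Q lam X) (hlam : ∀ i, 0 < lam i) (hγ0 : 0 < γ 0) (hγ1 : γ 1 < 0)
    {n : ℕ} (h : EvenLaw Q lam γ X n) : OddLaw Q lam γ X (n + 1) := by
  set c := ENNReal.ofReal (lam 0 ^ (n + 2) * lam 1 ^ (n + 1)) with hc
  have hK := measurable_oddKernel γ c (-γ 1 / γ 0) n
  refine ⟨volume, fun d u => c * (cone γ).indicator
      (fun p => ENNReal.ofReal (oddPoly (-γ 1 / γ 0) n p.1 p.2)) (u, d), inferInstance,
    hK, fun F hF => ?_, fun u d hud => ?_⟩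
  · have hk : Even (2 * n + 2) := by simp [parity_simps]
    have hl := hX.law (2 * n + 2)
    rw [if_pos hk] at hl
    have hFs : Measurable (Function.uncurry fun u d => F d u) := hF.comp measurable_swap
    have hF' := measurable_ite_height (γ := γ) hFs
    have key := lintegral_add_exponential ((measurable_upTime _).comp hX.measurable_pi)
      ((measurable_downTime _).comp hX.measurable_pi) (hX.measurable (2 * n + 2))
      (hX.measurable_weight γ _) (hX.indepFun_up γ (2 * n + 2)) (hlam 0) hl
      (measurable_evenKernel γ _ (-γ 1 / γ 0) n) h hF'
    have hm : Measurable (Function.uncurry fun u d =>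
        ENNReal.ofReal (exp (-lam 1 * d - lam 0 * u)) * (c * (cone γ).indicator
          (fun p => ENNReal.ofReal (oddPoly (-γ 1 / γ 0) n p.1 p.2)) (u, d)) * F d u) :=
      ((by fun_prop : Measurable fun p : ℝ × ℝ =>
        ENNReal.ofReal (exp (-lam 1 * p.2 - lam 0 * p.1))).mul (hK.comp measurable_swap)).mul
          (hF.comp measurable_swap)
    rw [lintegral_lintegral_swap hm.aemeasurable]
    calc _ = _ := lintegral_congr fun ω => by
          rw [show 2 * (n + 1) + 1 = 2 * n + 2 + 1 from rfl, weight_succ_mul, height,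
            downTime_succ_of_even hk, upTime_succ_of_even hk]
          rfl
      _ = _ := key
      _ = _ := by
          refine lintegral_congr fun d => lintegral_congr fun u => ?_
          by_cases hud : 0 ≤ γ 0 * u + γ 1 * d
          · rw [lintegral_const_mul, setLIntegral_cone_evenPoly hγ0 hγ1 n hud, if_pos hud, hc,
              pow_succ' (lam 0) (n + 1), mul_assoc (lam 0), ENNReal.ofReal_mul (hlam 0).le,
              ← mul_assoc (ENNReal.ofReal (lam 0)),
              show -lam 1 * d - lam 0 * u = -lam 0 * u - lam 1 * d by ring]
            · simp [indicator, cone, hud]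
            · exact measurable_evenKernel_left γ (-γ 1 / γ 0) n d
          · simp [indicator, cone, hud]
  · rw [lintegral_const_mul, setLIntegral_cone_oddPoly hγ0 hγ1 n hud]
    exact measurable_oddKernel_right γ (-γ 1 / γ 0) n u

lemma IsHoldingSequence.oddLaw [IsProbabilityMeasure Q] (hX : IsHoldingSequence Q lam X)
    (hlam : ∀ i, 0 < lam i) (hγ0 : 0 < γ 0) (hγ1 : γ 1 < 0) (n : ℕ) : OddLaw Q lam γ X n := by
  induction n with
  | zero => exact hX.oddLaw_zero hlam hγ0 hγ1
  | succ n ih => exact hX.oddLaw_succ_of_evenLaw hlam hγ0 hγ1 (hX.evenLaw_of_oddLaw hlam ih)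

lemma IsHoldingSequence.measure_meanderSet_odd [IsProbabilityMeasure Q]
    (hX : IsHoldingSequence Q lam X) (hlam : ∀ i, 0 < lam i) (hγ0 : 0 < γ 0) (hγ1 : γ 1 < 0)
    (t : ℝ) {B : Set ℝ} (hB : MeasurableSet B) (n : ℕ) :
    Q {ω | (fun k => X k ω) ∈ meanderSet γ t B (2 * n + 1)}
      = ∫⁻ u, {u | γ 0 * u + γ 1 * (t - u) ∈ B ∩ Ici 0}.indicator 1 u
        * (ENNReal.ofReal (exp (-lam 1 * (t - u) - lam 0 * u))
          * (ENNReal.ofReal (lam 0 ^ (n + 1) * lam 1 ^ n)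
            * if 0 ≤ t - u then ENNReal.ofReal (evenPoly (-γ 1 / γ 0) n u (t - u)) else 0)) := by
  obtain ⟨ν, K, hν, hK, hlaw, hint⟩ := hX.oddLaw hlam hγ0 hγ1 n
  have hk : ¬Even (2 * n + 1) := by simp
  have hl := hX.law (2 * n + 1)
  rw [if_neg hk] at hl
  have hS : MeasurableSet {u | γ 0 * u + γ 1 * (t - u) ∈ B ∩ Ici 0} :=
    (by fun_prop : Measurable fun u => γ 0 * u + γ 1 * (t - u)) (hB.inter measurableSet_Ici)
  have key := lintegral_exponential_overshoot ((measurable_downTime _).comp hX.measurable_pi)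
    ((measurable_upTime _).comp hX.measurable_pi) (hX.measurable (2 * n + 1))
    (hX.measurable_weight γ _) (hX.indepFun_down γ (2 * n + 1)) (hlam 1) hl hK hlaw t hS
  have hM := hX.measurable_pi (measurableSet_meanderSet γ t hB (2 * n + 1))
  calc _ = ∫⁻ ω, ((fun ω k => X k ω) ⁻¹' meanderSet γ t B (2 * n + 1)).indicator 1 ω ∂Q :=
        (lintegral_indicator_one hM).symm
    _ = _ := lintegral_congr fun ω => by
        unfold weight
        refine indicator_one_eq_mul ?_
        simp only [meanderSet, endpoint, hk, if_false, mem_preimage, mem_ofPred_eq,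
          Function.comp_apply, add_comm (upTime _ _)]
    _ = _ := key
    _ = _ := by
        refine lintegral_congr fun u => ?_
        by_cases hu : γ 0 * u + γ 1 * (t - u) ∈ B ∩ Ici 0
        · rw [hint u (t - u) hu.2]
        · simp only [indicator, mem_ofPred_eq, hu, if_false, zero_mul]

lemma IsHoldingSequence.measure_meanderSet_even [IsProbabilityMeasure Q]
    (hX : IsHoldingSequence Q lam X) (hlam : ∀ i, 0 < lam i) (hγ0 : 0 < γ 0) (hγ1 : γ 1 < 0)
    (t : ℝ) {B : Set ℝ} (hB : MeasurableSet B) (n : ℕ) :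
    Q {ω | (fun k => X k ω) ∈ meanderSet γ t B (2 * n + 2)}
      = ∫⁻ d, {d | γ 0 * (t - d) + γ 1 * d ∈ B ∩ Ici 0}.indicator 1 d
        * (ENNReal.ofReal (exp (-lam 0 * (t - d) - lam 1 * d))
          * (ENNReal.ofReal (lam 0 ^ (n + 1) * lam 1 ^ (n + 1))
            * if 0 ≤ d then ENNReal.ofReal (oddPoly (-γ 1 / γ 0) n (t - d) d) else 0)) := by
  have hlaw : EvenLaw Q lam γ X n := hX.evenLaw_of_oddLaw hlam (hX.oddLaw hlam hγ0 hγ1 n)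
  have hk : Even (2 * n + 2) := by simp [parity_simps]
  have hl := hX.law (2 * n + 2)
  rw [if_pos hk] at hl
  have hS : MeasurableSet {d | γ 0 * (t - d) + γ 1 * d ∈ B ∩ Ici 0} :=
    (by fun_prop : Measurable fun d => γ 0 * (t - d) + γ 1 * d) (hB.inter measurableSet_Ici)
  have key := lintegral_exponential_overshoot ((measurable_upTime _).comp hX.measurable_pi)
    ((measurable_downTime _).comp hX.measurable_pi) (hX.measurable (2 * n + 2))
    (hX.measurable_weight γ _) (hX.indepFun_up γ (2 * n + 2)) (hlam 0) hl
    (measurable_evenKernel γ _ (-γ 1 / γ 0) n) hlaw t hS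
  have hM := hX.measurable_pi (measurableSet_meanderSet γ t hB (2 * n + 2))
  calc _ = ∫⁻ ω, ((fun ω k => X k ω) ⁻¹' meanderSet γ t B (2 * n + 2)).indicator 1 ω ∂Q :=
        (lintegral_indicator_one hM).symm
    _ = _ := lintegral_congr fun ω => by
        unfold weight
        refine indicator_one_eq_mul ?_
        simp only [meanderSet, endpoint, hk, if_true, mem_preimage, mem_ofPred_eq,
          Function.comp_apply]
    _ = _ := key
    _ = _ := by
        refine lintegral_congr fun d => ?_
        by_cases hd : γ 0 * (t - d) + γ 1 * d ∈ B ∩ Ici 0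
        · rw [lintegral_const_mul, setLIntegral_cone_evenPoly hγ0 hγ1 n hd.2]
          exact measurable_evenKernel_left γ (-γ 1 / γ 0) n d
        · simp only [indicator, mem_ofPred_eq, hd, if_false, zero_mul]

lemma IsHoldingSequence.measure_meanderSet_zero (hX : IsHoldingSequence Q lam X)
    (hlam : ∀ i, 0 < lam i) (hγ0 : 0 < γ 0) {t : ℝ} (ht : 0 ≤ t) {B : Set ℝ}
    (hB : MeasurableSet B) :
    Q {ω | (fun k => X k ω) ∈ meanderSet γ t B 0}
      = ENNReal.ofReal (exp (-lam 0 * t)) * Measure.dirac (γ 0 * t) B := by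
  have hpos : 0 ≤ γ 0 * t := by positivity
  have hset : {ω | (fun k => X k ω) ∈ meanderSet γ t B 0} = {ω | t < X 0 ω ∧ γ 0 * t ∈ B} := by
    ext ω
    simp [meanderSet, endpoint, mem_staysNonneg_zero, ht, hpos]
  rw [hset, Measure.dirac_apply' _ hB]
  by_cases hm : γ 0 * t ∈ B
  · have : {ω | t < X 0 ω ∧ γ 0 * t ∈ B} = X 0 ⁻¹' Ioi t := by
      ext ω
      simp [hm]
    rw [this, ← Measure.map_apply (hX.measurable 0) measurableSet_Ioi, hX.law 0]
    simp [expMeasure_Ioi (hlam 0) ht, hm]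
  · simp [hm]

end Laws

end

/-! ### The densities -/

section

/-- The density of the endpoint of the positive meander with `2 n + 1` switchings. -/
noncomputable def oddDensity (lam γ : Fin 2 → ℝ) (t : ℝ) (n : ℕ) (x : ℝ) : ℝ :=
  lam 0 / xi0 γ t x * (zfun lam γ t x ^ n / (n ! : ℝ) ^ 2) * theta lam γ t x
    * ((x - γ 1 / ((n : ℝ) + 1) * xi1 γ t x) / γ 0)

/-- The density of the endpoint of the positive meander with `2 n + 2` switchings. -/
noncomputable def evenDensity (lam γ : Fin 2 → ℝ) (t : ℝ) (n : ℕ) (x : ℝ) : ℝ :=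
  lam 0 * lam 1 * (zfun lam γ t x ^ n / ((n ! : ℝ) * ((n + 1)! : ℝ))) * theta lam γ t x * (x / γ 0)

/-- The density of the endpoint of the positive meander with at least one switching. -/
noncomputable def totalDensity (lam γ : Fin 2 → ℝ) (t : ℝ) (x : ℝ) : ℝ :=
  lam 0 / γ 0 * (x / xi0 γ t x * calI0 lam γ t x
    + (lam 1 * x - γ 1 * (xi1 γ t x / xi0 γ t x)) * calI1 lam γ t x) * theta lam γ t x

lemma lintegral_comp_affine {a : ℝ} (ha : a ≠ 0) (b : ℝ) {f : ℝ → ℝ≥0∞} (hf : Measurable f) :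
    ∫⁻ y, f y = ∫⁻ x, ENNReal.ofReal |a| * f (a * x + b) := by
  have hfb : Measurable fun y => f (y + b) := by fun_prop
  rw [lintegral_const_mul _ (by fun_prop), ← lintegral_add_right_eq_self f b]
  conv_lhs => rw [← Real.smul_map_volume_mul_left ha]
  rw [lintegral_smul_measure, lintegral_map hfb (by fun_prop), smul_eq_mul]

section

variable {lam γ : Fin 2 → ℝ} {t x : ℝ}

lemma sub_xi0 (h : γ 0 - γ 1 ≠ 0) : t - xi0 γ t x = xi1 γ t x := by
  unfold xi0 xi1
  field_simp
  ring

lemma sub_xi1 (h : γ 0 - γ 1 ≠ 0) : t - xi1 γ t x = xi0 γ t x := by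
  rw [← sub_xi0 h, sub_sub_cancel]

lemma speed_xi (h : γ 0 - γ 1 ≠ 0) : γ 0 * xi0 γ t x + γ 1 * xi1 γ t x = x := by
  unfold xi0 xi1
  field_simp
  ring

lemma xi0_pos (hγ0 : 0 < γ 0) (hγ1 : γ 1 < 0) (h : γ 1 * t < x) : 0 < xi0 γ t x :=
  div_pos (by linarith) (by linarith)

lemma xi1_pos (hγ0 : 0 < γ 0) (hγ1 : γ 1 < 0) (h : x < γ 0 * t) : 0 < xi1 γ t x :=
  div_pos (by linarith) (by linarith)

/-- The weight `1 - r * n * d / ((n + 1) * u)` of the ballot polynomial, written with the endpoint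
`x = γ 0 * u + γ 1 * d`. -/
lemma oddDensity_eq (hγ0 : 0 < γ 0) (hγ1 : γ 1 < 0) (n : ℕ) (hx : xi0 γ t x ≠ 0) :
    oddDensity lam γ t n x
      = (γ 0 - γ 1)⁻¹ * (exp (-lam 1 * xi1 γ t x - lam 0 * xi0 γ t x)
        * (lam 0 ^ (n + 1) * lam 1 ^ n * evenPoly (-γ 1 / γ 0) n (xi0 γ t x) (xi1 γ t x))) := by
  have hx' := speed_xi (γ := γ) (t := t) (x := x) (by linarith)
  have h1 : ((n + 1)! : ℝ) = (n + 1) * n ! := by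
    rw [Nat.factorial_succ]
    push_cast
    ring
  unfold oddDensity theta zfun evenPoly
  rw [show -lam 1 * xi1 γ t x - lam 0 * xi0 γ t x = -lam 0 * xi0 γ t x - lam 1 * xi1 γ t x by ring,
    h1]
  generalize exp (-lam 0 * xi0 γ t x - lam 1 * xi1 γ t x) = e
  generalize xi0 γ t x = u at *
  generalize xi1 γ t x = d at *
  have hn : (n ! : ℝ) ≠ 0 := by positivity
  have hn1 : (n + 1 : ℝ) ≠ 0 := by positivity
  have hg : γ 0 - γ 1 ≠ 0 := by linarith
  have hg0 := hγ0.ne'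
  have hpow : (n : ℝ) * u ^ (n - 1) = n * u ^ n / u := by
    rcases n with _ | n
    · simp
    · rw [Nat.add_sub_cancel, pow_succ]
      field_simp
  rw [hpow, ← hx']
  simp only [mul_pow, pow_succ]
  field_simp
  ring

lemma evenDensity_eq (hγ0 : 0 < γ 0) (hγ1 : γ 1 < 0) (n : ℕ) :
    evenDensity lam γ t n x
      = (γ 0 - γ 1)⁻¹ * (exp (-lam 0 * xi0 γ t x - lam 1 * xi1 γ t x)
        * (lam 0 ^ (n + 1) * lam 1 ^ (n + 1)
          * oddPoly (-γ 1 / γ 0) n (xi0 γ t x) (xi1 γ t x))) := by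
  have hx' := speed_xi (γ := γ) (t := t) (x := x) (by linarith)
  unfold evenDensity theta zfun oddPoly
  generalize exp (-lam 0 * xi0 γ t x - lam 1 * xi1 γ t x) = e
  generalize xi0 γ t x = u at *
  generalize xi1 γ t x = d at *
  have hn : (n ! : ℝ) ≠ 0 := by positivity
  have hn1 : ((n + 1)! : ℝ) ≠ 0 := by positivity
  have hg : γ 0 - γ 1 ≠ 0 := by linarith
  have hg0 := hγ0.ne'
  rw [← hx']
  simp only [mul_pow, pow_succ]
  field_simp
  ring

lemma oddDensity_nonneg (hlam : ∀ i, 0 < lam i) (hγ0 : 0 < γ 0) (hγ1 : γ 1 < 0) (ht : 0 < t)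
    (n : ℕ) (hx : x ∈ Ioo 0 (γ 0 * t)) : 0 ≤ oddDensity lam γ t n x := by
  have h0 := xi0_pos (t := t) (x := x) hγ0 hγ1 (by nlinarith [hx.1])
  have h1 := xi1_pos hγ0 hγ1 hx.2
  have h2 := hlam 0
  have h3 := hlam 1
  have h4 : 0 < γ 0 - γ 1 := by linarith
  have h5 : 0 ≤ x - γ 1 / ((n : ℝ) + 1) * xi1 γ t x := by
    have : 0 ≤ -γ 1 / ((n : ℝ) + 1) * xi1 γ t x :=
      mul_nonneg (div_nonneg (by linarith) (by positivity)) h1.le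
    rw [neg_div, neg_mul] at this
    linarith [hx.1]
  unfold oddDensity zfun theta
  positivity

lemma evenDensity_nonneg (hlam : ∀ i, 0 < lam i) (hγ0 : 0 < γ 0) (hγ1 : γ 1 < 0) (ht : 0 < t)
    (n : ℕ) (hx : x ∈ Ioo 0 (γ 0 * t)) : 0 ≤ evenDensity lam γ t n x := by
  have h0 := xi0_pos (t := t) (x := x) hγ0 hγ1 (by nlinarith [hx.1])
  have h1 := xi1_pos hγ0 hγ1 hx.2
  have h2 := hlam 0
  have h3 := hlam 1
  have h4 : 0 < γ 0 - γ 1 := by linarith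
  have h5 := hx.1
  unfold evenDensity zfun theta
  positivity

lemma summable_calI0 (z : ℝ) : Summable fun n : ℕ => z ^ n / (n ! : ℝ) ^ 2 := by
  refine (Real.summable_pow_div_factorial |z|).of_norm_bounded fun n => ?_
  rw [norm_div, norm_pow, norm_pow, Real.norm_eq_abs, Real.norm_natCast]
  have : (1 : ℝ) ≤ n ! := by exact_mod_cast Nat.one_le_iff_ne_zero.2 (Nat.factorial_ne_zero n)
  gcongr
  nlinarith

lemma summable_calI1 (z : ℝ) : Summable fun n : ℕ => z ^ n / ((n ! : ℝ) * ((n + 1)! : ℝ)) := by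
  refine (Real.summable_pow_div_factorial |z|).of_norm_bounded fun n => ?_
  rw [norm_div, norm_pow, norm_mul, Real.norm_eq_abs, Real.norm_natCast, Real.norm_natCast]
  have : (1 : ℝ) ≤ (n + 1)! := by
    exact_mod_cast Nat.one_le_iff_ne_zero.2 (Nat.factorial_ne_zero (n + 1))
  gcongr
  exact le_mul_of_one_le_right (by positivity) this

lemma hasSum_density :
    HasSum (fun n => oddDensity lam γ t n x + evenDensity lam γ t n x)
      (totalDensity lam γ t x) := by
  have h0 : HasSum (fun n : ℕ => zfun lam γ t x ^ n / (n ! : ℝ) ^ 2) (calI0 lam γ t x) :=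
    (summable_calI0 _).hasSum
  have h1 : HasSum (fun n : ℕ => zfun lam γ t x ^ n / ((n ! : ℝ) * ((n + 1)! : ℝ)))
    (calI1 lam γ t x) := (summable_calI1 _).hasSum
  have := (h0.mul_left (lam 0 / γ 0 * (x / xi0 γ t x) * theta lam γ t x)).add
    (h1.mul_left (lam 0 / γ 0 * (lam 1 * x - γ 1 * (xi1 γ t x / xi0 γ t x)) * theta lam γ t x))
  have htot : totalDensity lam γ t x
      = lam 0 / γ 0 * (x / xi0 γ t x) * theta lam γ t x * calI0 lam γ t x
        + lam 0 / γ 0 * (lam 1 * x - γ 1 * (xi1 γ t x / xi0 γ t x)) * theta lam γ t x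
          * calI1 lam γ t x := by
    unfold totalDensity
    ring
  rw [htot]
  refine (congrArg (fun f : ℕ → ℝ => HasSum f _) (funext fun n => ?_)).mpr this
  have hf : ((n + 1)! : ℝ) = (n + 1) * n ! := by
    rw [Nat.factorial_succ]
    push_cast
    ring
  have hn : (n ! : ℝ) ≠ 0 := by positivity
  have hn1 : (n + 1 : ℝ) ≠ 0 := by positivity
  unfold oddDensity evenDensity
  rw [hf]
  field_simp
  ring

lemma calI0_eq_besselI (hz : 0 ≤ zfun lam γ t x) :
    calI0 lam γ t x = besselI 0 (2 * √(zfun lam γ t x)) := by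
  refine tsum_congr fun n => ?_
  rw [mul_div_cancel_left₀ _ two_ne_zero, add_zero, add_zero, pow_mul, Real.sq_sqrt hz,
    sq (n ! : ℝ)]

lemma calI1_eq_besselI (hz : 0 < zfun lam γ t x) :
    calI1 lam γ t x = besselI 1 (2 * √(zfun lam γ t x)) / √(zfun lam γ t x) := by
  unfold calI1 besselI
  rw [← tsum_div_const]
  refine tsum_congr fun n => ?_
  have : √(zfun lam γ t x) ≠ 0 := (Real.sqrt_pos.2 hz).ne'
  rw [mul_div_cancel_left₀ _ two_ne_zero, pow_succ, pow_mul, Real.sq_sqrt hz.le]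
  field_simp

/-- The endpoint densities may be restricted to the open interval, since its ends are null. The
condition `p x` stands for `0 ≤ xi1 γ t x`, which bounds the endpoint by `γ 0 * t`. -/
lemma lintegral_eq_setLIntegral_Ioo {B : Set ℝ}
    (hB : MeasurableSet B) {h : ℝ → ℝ≥0∞} {g : ℝ → ℝ} {p : ℝ → Prop} [DecidablePred p]
    (hp : ∀ x, p x ↔ x ≤ γ 0 * t)
    (hg : ∀ x ∈ Ioo 0 (γ 0 * t), h x = ENNReal.ofReal (g x)) :
    ∫⁻ x, (B ∩ Ici 0).indicator 1 x * (if p x then h x else 0)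
      = ∫⁻ x in B, ENNReal.ofReal ((Ioo 0 (γ 0 * t)).indicator g x) := by
  rw [← lintegral_indicator hB]
  have hne : ∀ a : ℝ, ∀ᵐ x : ℝ, x ≠ a := fun a => compl_mem_ae_iff.2 (measure_singleton a)
  refine lintegral_congr_ae ?_
  filter_upwards [hne 0, hne (γ 0 * t)] with x h0 ht
  by_cases hxB : x ∈ B
  · by_cases hx : x ∈ Ioo 0 (γ 0 * t)
    · rw [indicator_of_mem (show x ∈ B ∩ Ici 0 from ⟨hxB, hx.1.le⟩),
        if_pos ((hp x).2 hx.2.le), indicator_of_mem hxB, indicator_of_mem hx, hg x hx,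
        Pi.one_apply, one_mul]
    · rw [indicator_of_mem hxB, indicator_of_notMem hx, ENNReal.ofReal_zero]
      by_cases hx0 : 0 ≤ x
      · rw [if_neg fun hpx => hx ⟨lt_of_le_of_ne hx0 h0.symm, lt_of_le_of_ne ((hp x).1 hpx) ht⟩,
          mul_zero]
      · rw [indicator_of_notMem fun hx' => hx0 hx'.2, zero_mul]
  · rw [indicator_of_notMem fun hx' => hxB hx'.1, indicator_of_notMem hxB, zero_mul]

end

variable {Ω : Type*} [MeasurableSpace Ω] {Q : Measure Ω} {lam γ : Fin 2 → ℝ} {X : ℕ → Ω → ℝ}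

lemma IsHoldingSequence.measure_meanderSet_oddDensity [IsProbabilityMeasure Q]
    (hX : IsHoldingSequence Q lam X) (hlam : ∀ i, 0 < lam i) (hγ0 : 0 < γ 0) (hγ1 : γ 1 < 0)
    {t : ℝ} (ht : 0 < t) {B : Set ℝ} (hB : MeasurableSet B) (n : ℕ) :
    Q {ω | (fun k => X k ω) ∈ meanderSet γ t B (2 * n + 1)}
      = ∫⁻ x in B, ENNReal.ofReal ((Ioo 0 (γ 0 * t)).indicator (oddDensity lam γ t n) x) := by
  have hg : 0 < γ 0 - γ 1 := by linarith
  -- substitute `u = xi0 γ t x`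
  rw [hX.measure_meanderSet_odd hlam hγ0 hγ1 t hB n,
    lintegral_comp_affine (inv_ne_zero hg.ne') (-(γ 1 * t / (γ 0 - γ 1)))]
  · have hxi : ∀ x, (γ 0 - γ 1)⁻¹ * x + -(γ 1 * t / (γ 0 - γ 1)) = xi0 γ t x := by
      intro x
      unfold xi0
      field_simp
      ring
    simp only [hxi, sub_xi0 hg.ne']
    rw [← lintegral_eq_setLIntegral_Ioo (p := fun x => 0 ≤ xi1 γ t x) (h := fun x =>
      ENNReal.ofReal |(γ 0 - γ 1)⁻¹|
        * (ENNReal.ofReal (exp (-lam 1 * xi1 γ t x - lam 0 * xi0 γ t x))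
        * (ENNReal.ofReal (lam 0 ^ (n + 1) * lam 1 ^ n)
          * ENNReal.ofReal (evenPoly (-γ 1 / γ 0) n (xi0 γ t x) (xi1 γ t x))))) hB]
    · refine lintegral_congr fun x => ?_
      have : {u | γ 0 * u + γ 1 * (t - u) ∈ B ∩ Ici 0}.indicator (1 : ℝ → ℝ≥0∞) (xi0 γ t x)
          = (B ∩ Ici 0).indicator 1 x := by
        refine indicator_one_congr ?_
        rw [mem_ofPred_eq, sub_xi0 hg.ne', speed_xi hg.ne']
      rw [this]
      by_cases hx : 0 ≤ xi1 γ t x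
      · simp only [hx, if_true]
        ring
      · simp only [hx, if_false, mul_zero]
    · intro x
      rw [xi1, le_div_iff₀ hg, zero_mul, sub_nonneg]
    · intro x hx
      have h0 := xi0_pos (t := t) (x := x) hγ0 hγ1 (by nlinarith [hx.1])
      have h2 : 0 ≤ lam 0 ^ (n + 1) * lam 1 ^ n :=
        mul_nonneg (pow_nonneg (hlam 0).le _) (pow_nonneg (hlam 1).le _)
      rw [oddDensity_eq hγ0 hγ1 n h0.ne', abs_of_pos (inv_pos.2 hg),
        ENNReal.ofReal_mul (inv_nonneg.2 hg.le), ENNReal.ofReal_mul (exp_nonneg _),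
        ENNReal.ofReal_mul h2]
  · have h1 : Measurable fun u => γ 0 * u + γ 1 * (t - u) := by fun_prop
    have h2 : Measurable fun u => evenPoly (-γ 1 / γ 0) n u (t - u) :=
      (continuous_evenPoly _ n).measurable.comp (by fun_prop : Measurable fun u => (u, t - u))
    exact (measurable_one.indicator (h1 (hB.inter measurableSet_Ici))).mul
      ((by fun_prop : Measurable fun u =>
        ENNReal.ofReal (exp (-lam 1 * (t - u) - lam 0 * u))).mul
        ((Measurable.ite (measurableSet_le measurable_const (by fun_prop)) h2.ennreal_ofReal
          measurable_const).const_mul _))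

lemma IsHoldingSequence.measure_meanderSet_evenDensity [IsProbabilityMeasure Q]
    (hX : IsHoldingSequence Q lam X) (hlam : ∀ i, 0 < lam i) (hγ0 : 0 < γ 0) (hγ1 : γ 1 < 0)
    (t : ℝ) {B : Set ℝ} (hB : MeasurableSet B) (n : ℕ) :
    Q {ω | (fun k => X k ω) ∈ meanderSet γ t B (2 * n + 2)}
      = ∫⁻ x in B, ENNReal.ofReal ((Ioo 0 (γ 0 * t)).indicator (evenDensity lam γ t n) x) := by
  have hg : 0 < γ 0 - γ 1 := by linarith
  -- substitute `d = xi1 γ t x`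
  rw [hX.measure_meanderSet_even hlam hγ0 hγ1 t hB n,
    lintegral_comp_affine (neg_ne_zero.2 (inv_ne_zero hg.ne')) (γ 0 * t / (γ 0 - γ 1))]
  · have hxi : ∀ x, -(γ 0 - γ 1)⁻¹ * x + γ 0 * t / (γ 0 - γ 1) = xi1 γ t x := by
      intro x
      unfold xi1
      field_simp
      ring
    simp only [hxi, sub_xi1 hg.ne']
    rw [← lintegral_eq_setLIntegral_Ioo (p := fun x => 0 ≤ xi1 γ t x) (h := fun x =>
      ENNReal.ofReal |-(γ 0 - γ 1)⁻¹|
        * (ENNReal.ofReal (exp (-lam 0 * xi0 γ t x - lam 1 * xi1 γ t x))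
          * (ENNReal.ofReal (lam 0 ^ (n + 1) * lam 1 ^ (n + 1))
            * ENNReal.ofReal (oddPoly (-γ 1 / γ 0) n (xi0 γ t x) (xi1 γ t x))))) hB]
    · refine lintegral_congr fun x => ?_
      have : {d | γ 0 * (t - d) + γ 1 * d ∈ B ∩ Ici 0}.indicator (1 : ℝ → ℝ≥0∞) (xi1 γ t x)
          = (B ∩ Ici 0).indicator 1 x := by
        refine indicator_one_congr ?_
        rw [mem_ofPred_eq, sub_xi1 hg.ne', speed_xi hg.ne']
      rw [this]
      by_cases hx : 0 ≤ xi1 γ t x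
      · simp only [hx, if_true]
        ring
      · simp only [hx, if_false, mul_zero]
    · intro x
      rw [xi1, le_div_iff₀ hg, zero_mul, sub_nonneg]
    · intro x hx
      have h2 : 0 ≤ lam 0 ^ (n + 1) * lam 1 ^ (n + 1) :=
        mul_nonneg (pow_nonneg (hlam 0).le _) (pow_nonneg (hlam 1).le _)
      rw [evenDensity_eq hγ0 hγ1 n, abs_neg, abs_of_pos (inv_pos.2 hg),
        ENNReal.ofReal_mul (inv_nonneg.2 hg.le), ENNReal.ofReal_mul (exp_nonneg _),
        ENNReal.ofReal_mul h2]
  · have h1 : Measurable fun d => γ 0 * (t - d) + γ 1 * d := by fun_prop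
    have h2 : Measurable fun d => oddPoly (-γ 1 / γ 0) n (t - d) d :=
      (continuous_oddPoly _ n).measurable.comp (by fun_prop : Measurable fun d => (t - d, d))
    exact (measurable_one.indicator (h1 (hB.inter measurableSet_Ici))).mul
      ((by fun_prop : Measurable fun d =>
        ENNReal.ofReal (exp (-lam 0 * (t - d) - lam 1 * d))).mul
        ((Measurable.ite (measurableSet_le measurable_const (by fun_prop)) h2.ennreal_ofReal
          measurable_const).const_mul _))

end

/-! ### The positive meander -/

section

lemma measurable_oddDensity (lam γ : Fin 2 → ℝ) (t : ℝ) (n : ℕ) :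
    Measurable (oddDensity lam γ t n) := by
  unfold oddDensity zfun theta xi0 xi1
  fun_prop

lemma measurable_evenDensity (lam γ : Fin 2 → ℝ) (t : ℝ) (n : ℕ) :
    Measurable (evenDensity lam γ t n) := by
  unfold evenDensity zfun theta xi0 xi1
  fun_prop

lemma tsum_lintegral_density {lam γ : Fin 2 → ℝ} (hlam : ∀ i, 0 < lam i) (hγ0 : 0 < γ 0)
    (hγ1 : γ 1 < 0) {t : ℝ} (ht : 0 < t) (B : Set ℝ) :
    ∑' n, ((∫⁻ x in B, ENNReal.ofReal ((Ioo 0 (γ 0 * t)).indicator (oddDensity lam γ t n) x))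
        + ∫⁻ x in B, ENNReal.ofReal ((Ioo 0 (γ 0 * t)).indicator (evenDensity lam γ t n) x))
      = ∫⁻ x in B, ENNReal.ofReal ((Ioo 0 (γ 0 * t)).indicator (totalDensity lam γ t) x) := by
  have ho : ∀ n, Measurable fun x =>
      ENNReal.ofReal ((Ioo 0 (γ 0 * t)).indicator (oddDensity lam γ t n) x) := fun n =>
    ((measurable_oddDensity lam γ t n).indicator measurableSet_Ioo).ennreal_ofReal
  have he : ∀ n, Measurable fun x =>
      ENNReal.ofReal ((Ioo 0 (γ 0 * t)).indicator (evenDensity lam γ t n) x) := fun n =>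
    ((measurable_evenDensity lam γ t n).indicator measurableSet_Ioo).ennreal_ofReal
  simp_rw [← lintegral_add_left (ho _)]
  rw [← lintegral_tsum (f := fun n x =>
      ENNReal.ofReal ((Ioo 0 (γ 0 * t)).indicator (oddDensity lam γ t n) x)
        + ENNReal.ofReal ((Ioo 0 (γ 0 * t)).indicator (evenDensity lam γ t n) x))
    fun n => ((ho n).add (he n)).aemeasurable]
  refine lintegral_congr fun x => ?_
  by_cases hx : x ∈ Ioo 0 (γ 0 * t)
  · simp only [indicator_of_mem hx]
    have h1 := fun n => oddDensity_nonneg hlam hγ0 hγ1 ht n hx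
    have h2 := fun n => evenDensity_nonneg hlam hγ0 hγ1 ht n hx
    have hs := hasSum_density (lam := lam) (γ := γ) (t := t) (x := x)
    rw [← hs.tsum_eq, ENNReal.ofReal_tsum_of_nonneg (fun n => add_nonneg (h1 n) (h2 n)) hs.summable]
    exact tsum_congr fun n => (ENNReal.ofReal_add (h1 n) (h2 n)).symm
  · simp [indicator_of_notMem hx]

variable {Ω : Type*} [MeasurableSpace Ω] {P : Measure Ω}
  {lam γ : Fin 2 → ℝ} {ε : ℝ → Ω → Fin 2} {τ : ℕ → Ω → ℝ}

lemma isProbabilityMeasure_startedAt [IsProbabilityMeasure P] {i : Fin 2}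
    (h : P {ω | ε 0 ω = i} ≠ 0) :
    IsProbabilityMeasure (startedAt P ε i) :=
  cond_isProbabilityMeasure h

/-- Under `P₀` the meander events are, up to null sets, events on a measurable version of the
sequence of holding times. -/
lemma IsTwoStateMarkov.exists_holdingSequence (hε : IsTwoStateMarkov P lam ε τ)
    (h : P {ω | ε 0 ω = 0} ≠ 0) (γ : Fin 2 → ℝ) {t : ℝ} (ht : 0 ≤ t) :
    ∃ X : ℕ → Ω → ℝ, IsHoldingSequence (startedAt P ε 0) lam X ∧ ∀ B n,
      posMeander γ ε τ t B n =ᵐ[startedAt P ε 0]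
        {ω | (fun k => X k ω) ∈ meanderSet γ t B n} := by
  have hlaw := hε.holding_law 0 h
  have hX := fun n => (hlaw n).aemeasurable.ae_eq_mk
  refine ⟨fun n => (hlaw n).aemeasurable.mk _,
    ⟨fun n => (hlaw n).aemeasurable.measurable_mk, (hε.holding_indep 0 h).congr hX, fun n => ?_⟩,
    fun B n => ?_⟩
  · rw [← Measure.map_congr (hX n), (hlaw n).map_eq]
    rfl
  · have hms : MeasurableSet {ω | ε 0 ω = 0} :=
      hε.measurable_state 0 le_rfl (measurableSet_singleton 0)
    have h0 : ∀ᵐ ω ∂(startedAt P ε 0), ε 0 ω = 0 := ae_cond_mem hms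
    have hsw : ∀ᵐ ω ∂(startedAt P ε 0), IsSwitchingTimes (fun s => ε s ω) (fun n => τ n ω) :=
      cond_absolutelyContinuous.ae_le hε.switching
    refine eventuallyEq_set.2 ?_
    filter_upwards [h0, hsw, ae_all_iff.2 hX] with ω h0 hsw hX
    rw [mem_posMeander_iff hsw h0 ht, funext hX]

lemma posMeander_zero (hε : IsTwoStateMarkov P lam ε τ) (hlam : ∀ i, 0 < lam i) (hγ0 : 0 < γ 0)
    {t : ℝ} (ht : 0 < t) (h : P {ω | ε 0 ω = 0} ≠ 0) {B : Set ℝ} (hB : MeasurableSet B) :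
    startedAt P ε 0 (posMeander γ ε τ t B 0)
      = ENNReal.ofReal (exp (-lam 0 * t)) * Measure.dirac (γ 0 * t) B := by
  obtain ⟨X, hX, hae⟩ := hε.exists_holdingSequence h γ ht.le
  rw [measure_congr (hae B 0), hX.measure_meanderSet_zero hlam hγ0 ht.le hB]

variable [IsProbabilityMeasure P]

lemma posMeander_odd (hε : IsTwoStateMarkov P lam ε τ) (hlam : ∀ i, 0 < lam i) (hγ0 : 0 < γ 0)
    (hγ1 : γ 1 < 0) {t : ℝ} (ht : 0 < t) (h : P {ω | ε 0 ω = 0} ≠ 0) {B : Set ℝ}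
    (hB : MeasurableSet B) (n : ℕ) :
    startedAt P ε 0 (posMeander γ ε τ t B (2 * n + 1))
      = ∫⁻ x in B, ENNReal.ofReal ((Ioo 0 (γ 0 * t)).indicator (oddDensity lam γ t n) x) := by
  have := isProbabilityMeasure_startedAt h
  obtain ⟨X, hX, hae⟩ := hε.exists_holdingSequence h γ ht.le
  rw [measure_congr (hae B _), hX.measure_meanderSet_oddDensity hlam hγ0 hγ1 ht hB]

lemma posMeander_even (hε : IsTwoStateMarkov P lam ε τ) (hlam : ∀ i, 0 < lam i) (hγ0 : 0 < γ 0)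
    (hγ1 : γ 1 < 0) {t : ℝ} (ht : 0 < t) (h : P {ω | ε 0 ω = 0} ≠ 0) {B : Set ℝ}
    (hB : MeasurableSet B) (n : ℕ) :
    startedAt P ε 0 (posMeander γ ε τ t B (2 * n + 2))
      = ∫⁻ x in B, ENNReal.ofReal ((Ioo 0 (γ 0 * t)).indicator (evenDensity lam γ t n) x) := by
  have := isProbabilityMeasure_startedAt h
  obtain ⟨X, hX, hae⟩ := hε.exists_holdingSequence h γ ht.le
  rw [measure_congr (hae B _), hX.measure_meanderSet_evenDensity hlam hγ0 hγ1 t hB]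

lemma posMeander_total (hε : IsTwoStateMarkov P lam ε τ) (hlam : ∀ i, 0 < lam i) (hγ0 : 0 < γ 0)
    (hγ1 : γ 1 < 0) {t : ℝ} (ht : 0 < t) (h : P {ω | ε 0 ω = 0} ≠ 0) {B : Set ℝ}
    (hB : MeasurableSet B) :
    startedAt P ε 0 {ω | position γ ε t ω ∈ B ∧ runMin γ ε t ω = 0}
      = ENNReal.ofReal (exp (-lam 0 * t)) * Measure.dirac (γ 0 * t) B
        + ∫⁻ x in B, ENNReal.ofReal ((Ioo 0 (γ 0 * t)).indicator (totalDensity lam γ t) x) := by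
  obtain ⟨X, hX, hae⟩ := hε.exists_holdingSequence h γ ht.le
  have hun : {ω | position γ ε t ω ∈ B ∧ runMin γ ε t ω = 0} = ⋃ n, posMeander γ ε τ t B n := by
    ext ω
    simp [posMeander]
  have hnull : ∀ n, NullMeasurableSet (posMeander γ ε τ t B n) (startedAt P ε 0) := fun n =>
    (hX.measurable_pi (measurableSet_meanderSet γ t hB n)).nullMeasurableSet.congr (hae B n).symm
  have hdisj : Pairwise (Function.onFun (AEDisjoint (startedAt P ε 0))
      (posMeander γ ε τ t B)) := fun m n hmn =>
    Disjoint.aedisjoint (disjoint_left.2 fun ω hm hn => hmn (hm.2.2.symm.trans hn.2.2))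
  rw [hun, measure_iUnion₀ hdisj hnull, tsum_eq_zero_add' ENNReal.summable,
    posMeander_zero hε hlam hγ0 ht h hB, ← tsum_even_add_odd ENNReal.summable ENNReal.summable,
    ← ENNReal.tsum_add, ← tsum_lintegral_density hlam hγ0 hγ1 ht]
  congr 1
  refine tsum_congr fun n => ?_
  rw [posMeander_odd hε hlam hγ0 hγ1 ht h hB, ← posMeander_even hε hlam hγ0 hγ1 ht h hB]

/-! ### Reflection -/

/-- The process with the two states interchanged. -/
def swapStates {Ω : Type*} (ε : ℝ → Ω → Fin 2) (s : ℝ) (ω : Ω) : Fin 2 := 1 - ε s ω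

section SwapStates

variable {Ω : Type*} {ε : ℝ → Ω → Fin 2}

lemma one_sub_eq_iff (i j : Fin 2) : 1 - i = j ↔ i = 1 - j := by
  constructor <;> rintro rfl <;> simp

lemma swapStates_eq_iff (i : Fin 2) (s : ℝ) (ω : Ω) : swapStates ε s ω = i ↔ ε s ω = 1 - i :=
  one_sub_eq_iff _ _

lemma position_swapStates (γ : Fin 2 → ℝ) (t : ℝ) (ω : Ω) :
    position (fun i => -γ (1 - i)) (swapStates ε) t ω = -position γ ε t ω := by
  simp [position, swapStates]

lemma runMin_swapStates (γ : Fin 2 → ℝ) (t : ℝ) (ω : Ω) :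
    runMin (fun i => -γ (1 - i)) (swapStates ε) t ω = -runMax γ ε t ω := by
  unfold runMin runMax
  simp only [position_swapStates]
  rw [← Real.sInf_neg, ← image_neg_eq_neg, image_image]

lemma negMeander_eq_posMeander_swapStates (γ : Fin 2 → ℝ) (τ : ℕ → Ω → ℝ) (t : ℝ)
    (B : Set ℝ) (n : ℕ) :
    negMeander γ ε τ t B n
      = posMeander (fun i => -γ (1 - i)) (swapStates ε) τ t (Neg.neg ⁻¹' B) n := by
  simp [negMeander, posMeander, position_swapStates, runMin_swapStates]

lemma startedAt_swapStates [MeasurableSpace Ω] (P : Measure Ω) (i : Fin 2) :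
    startedAt P (swapStates ε) i = startedAt P ε (1 - i) := by
  simp only [startedAt, swapStates_eq_iff]

lemma IsTwoStateMarkov.swapStates [MeasurableSpace Ω] {P : Measure Ω} {lam : Fin 2 → ℝ}
    {τ : ℕ → Ω → ℝ} (hε : IsTwoStateMarkov P lam ε τ) :
    IsTwoStateMarkov P (fun i => lam (1 - i)) (swapStates ε) τ where
  measurable_state t ht := (measurable_of_finite fun i : Fin 2 => 1 - i).comp
    (hε.measurable_state t ht)
  switching := by
    filter_upwards [hε.switching] with ω h
    exact ⟨h.zero, h.strictMono, h.tendsto_atTop,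
      fun n s hs => congrArg (fun i => 1 - i) (h.constant n s hs),
      fun n hn => h.switch n (sub_right_injective hn)⟩
  holding_law i hi n := by
    simp only [swapStates_eq_iff] at hi
    rw [startedAt_swapStates, apply_ite (fun i => 1 - i)]
    exact hε.holding_law (1 - i) hi n
  holding_indep i hi := by
    simp only [swapStates_eq_iff] at hi
    rw [startedAt_swapStates]
    exact hε.holding_indep (1 - i) hi

end SwapStates

lemma setLIntegral_neg_preimage {B : Set ℝ} (hB : MeasurableSet B) (f : ℝ → ℝ≥0∞) :
    ∫⁻ x in Neg.neg ⁻¹' B, f x = ∫⁻ x in B, f (-x) := by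
  rw [← lintegral_indicator (hB.preimage measurable_neg), ← lintegral_indicator hB,
    ← lintegral_neg_eq_self]
  refine lintegral_congr fun x => ?_
  by_cases hx : x ∈ B <;> simp [indicator, hx]

lemma dirac_neg_preimage {B : Set ℝ} (hB : MeasurableSet B) (a t : ℝ) :
    Measure.dirac (-a * t) (Neg.neg ⁻¹' B) = Measure.dirac (a * t) B := by
  rw [Measure.dirac_apply' _ (hB.preimage measurable_neg), Measure.dirac_apply' _ hB]
  exact indicator_one_congr (by rw [mem_preimage, neg_mul, neg_neg])

lemma ofReal_indicator_Ioo_neg (a : ℝ) {f g : ℝ → ℝ} (h : ∀ x, f (-x) = g x) (x : ℝ) :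
    ENNReal.ofReal ((Ioo 0 (-a)).indicator f (-x)) = ENNReal.ofReal ((Ioo a 0).indicator g x) := by
  have : -x ∈ Ioo 0 (-a) ↔ x ∈ Ioo a 0 := by
    simp only [mem_Ioo, Left.neg_pos_iff, neg_lt_neg_iff]
    tauto
  by_cases hx : x ∈ Ioo a 0
  · rw [indicator_of_mem hx, indicator_of_mem (this.2 hx), h]
  · rw [indicator_of_notMem hx, indicator_of_notMem (mt this.1 hx)]

section SwapStatesFunctions

variable (lam γ : Fin 2 → ℝ) (t x : ℝ)

lemma xi0_swapStates : xi0 (fun i => -γ (1 - i)) t (-x) = xi1 γ t x := by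
  simp only [xi0, xi1, sub_self, sub_zero]
  congr 1 <;> ring

lemma xi1_swapStates : xi1 (fun i => -γ (1 - i)) t (-x) = xi0 γ t x := by
  simp only [xi0, xi1, sub_self, sub_zero]
  congr 1 <;> ring

lemma zfun_swapStates :
    zfun (fun i => lam (1 - i)) (fun i => -γ (1 - i)) t (-x) = zfun lam γ t x := by
  simp only [zfun, xi0_swapStates, xi1_swapStates, sub_self, sub_zero]
  ring

lemma theta_swapStates :
    theta (fun i => lam (1 - i)) (fun i => -γ (1 - i)) t (-x) = theta lam γ t x := by
  simp only [theta, xi0_swapStates, xi1_swapStates, sub_self, sub_zero]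
  congr 1
  · congr 1
    ring
  · ring

end SwapStatesFunctions

end

end Telegraph

theorem theorem2 {Ω : Type*} [MeasurableSpace Ω] (P : Measure Ω) [IsProbabilityMeasure P]
    (lam γ : Fin 2 → ℝ) (hlam : ∀ i, 0 < lam i) (hγ0 : 0 < γ 0) (hγ1 : γ 1 < 0)
    (ε : ℝ → Ω → Fin 2) (τ : ℕ → Ω → ℝ) (hε : Telegraph.IsTwoStateMarkov P lam ε τ)
    (t : ℝ) (ht : 0 < t) :
    -- the positive meander, started in state 0
    (P {ω | ε 0 ω = 0} ≠ 0 → ∀ B : Set ℝ, MeasurableSet B →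
      (Telegraph.startedAt P ε 0 (Telegraph.posMeander γ ε τ t B 0)
        = ENNReal.ofReal (Real.exp (-lam 0 * t)) * Measure.dirac (γ 0 * t) B) ∧
      (∀ n : ℕ, Telegraph.startedAt P ε 0 (Telegraph.posMeander γ ε τ t B (2 * n + 1))
        = ∫⁻ x in B, ENNReal.ofReal ((Ioo 0 (γ 0 * t)).indicator (fun x =>
            lam 0 / Telegraph.xi0 γ t x
              * (Telegraph.zfun lam γ t x ^ n / (n ! : ℝ) ^ 2)
              * Telegraph.theta lam γ t x
              * ((x - γ 1 / ((n : ℝ) + 1) * Telegraph.xi1 γ t x) / γ 0)) x)) ∧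
      (∀ n : ℕ, Telegraph.startedAt P ε 0 (Telegraph.posMeander γ ε τ t B (2 * n + 2))
        = ∫⁻ x in B, ENNReal.ofReal ((Ioo 0 (γ 0 * t)).indicator (fun x =>
            lam 0 * lam 1
              * (Telegraph.zfun lam γ t x ^ n / ((n ! : ℝ) * ((n + 1)! : ℝ)))
              * Telegraph.theta lam γ t x * (x / γ 0)) x)) ∧
      (Telegraph.startedAt P ε 0
          {ω | Telegraph.position γ ε t ω ∈ B ∧ Telegraph.runMin γ ε t ω = 0}
        = ENNReal.ofReal (Real.exp (-lam 0 * t)) * Measure.dirac (γ 0 * t) B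
          + ∫⁻ x in B, ENNReal.ofReal ((Ioo 0 (γ 0 * t)).indicator (fun x =>
            lam 0 / γ 0
              * (x / Telegraph.xi0 γ t x * Telegraph.calI0 lam γ t x
                + (lam 1 * x - γ 1 * (Telegraph.xi1 γ t x / Telegraph.xi0 γ t x))
                  * Telegraph.calI1 lam γ t x)
              * Telegraph.theta lam γ t x) x))) ∧
    -- the negative meander, started in state 1
    (P {ω | ε 0 ω = 1} ≠ 0 → ∀ B : Set ℝ, MeasurableSet B →
      (Telegraph.startedAt P ε 1 (Telegraph.negMeander γ ε τ t B 0)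
        = ENNReal.ofReal (Real.exp (-lam 1 * t)) * Measure.dirac (γ 1 * t) B) ∧
      (∀ n : ℕ, Telegraph.startedAt P ε 1 (Telegraph.negMeander γ ε τ t B (2 * n + 1))
        = ∫⁻ x in B, ENNReal.ofReal ((Ioo (γ 1 * t) 0).indicator (fun x =>
            lam 1 / Telegraph.xi1 γ t x
              * (Telegraph.zfun lam γ t x ^ n / (n ! : ℝ) ^ 2)
              * Telegraph.theta lam γ t x
              * ((x - γ 0 / ((n : ℝ) + 1) * Telegraph.xi0 γ t x) / γ 1)) x)) ∧
      (∀ n : ℕ, Telegraph.startedAt P ε 1 (Telegraph.negMeander γ ε τ t B (2 * n + 2))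
        = ∫⁻ x in B, ENNReal.ofReal ((Ioo (γ 1 * t) 0).indicator (fun x =>
            lam 0 * lam 1
              * (Telegraph.zfun lam γ t x ^ n / ((n ! : ℝ) * ((n + 1)! : ℝ)))
              * Telegraph.theta lam γ t x * (x / γ 1)) x)) ∧
      (Telegraph.startedAt P ε 1
          {ω | Telegraph.position γ ε t ω ∈ B ∧ Telegraph.runMax γ ε t ω = 0}
        = ENNReal.ofReal (Real.exp (-lam 1 * t)) * Measure.dirac (γ 1 * t) B
          + ∫⁻ x in B, ENNReal.ofReal ((Ioo (γ 1 * t) 0).indicator (fun x =>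
            lam 1 / γ 1
              * (x / Telegraph.xi1 γ t x * Telegraph.calI0 lam γ t x
                + (lam 0 * x - γ 0 * (Telegraph.xi0 γ t x / Telegraph.xi1 γ t x))
                  * Telegraph.calI1 lam γ t x)
              * Telegraph.theta lam γ t x) x))) ∧
    -- the series in the summed formulae are modified Bessel functions
    (∀ x ∈ Ioo (γ 1 * t) (γ 0 * t),
      Telegraph.calI0 lam γ t x = Telegraph.besselI 0 (2 * √(Telegraph.zfun lam γ t x)) ∧
      Telegraph.calI1 lam γ t x
        = Telegraph.besselI 1 (2 * √(Telegraph.zfun lam γ t x))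
          / √(Telegraph.zfun lam γ t x)) := by
  refine ⟨fun h B hB => ⟨Telegraph.posMeander_zero hε hlam hγ0 ht h hB,
    Telegraph.posMeander_odd hε hlam hγ0 hγ1 ht h hB,
    Telegraph.posMeander_even hε hlam hγ0 hγ1 ht h hB,
    Telegraph.posMeander_total hε hlam hγ0 hγ1 ht h hB⟩, fun h B hB => ?_, fun x hx => ?_⟩
  · -- the negative meander is the positive meander of the process with interchanged states
    have hlam' : ∀ i, 0 < (fun i => lam (1 - i)) i := fun i => hlam _
    have hγ0' : 0 < (fun i => -γ (1 - i)) 0 := neg_pos.2 hγ1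
    have hγ1' : (fun i => -γ (1 - i)) 1 < 0 := neg_lt_zero.2 hγ0
    have h' : P {ω | Telegraph.swapStates ε 0 ω = 0} ≠ 0 := by
      simpa [Telegraph.swapStates_eq_iff] using h
    have hB' : MeasurableSet (Neg.neg ⁻¹' B) := hB.preimage measurable_neg
    have hs : Telegraph.startedAt P ε 1 = Telegraph.startedAt P (Telegraph.swapStates ε) 0 := by
      rw [Telegraph.startedAt_swapStates, sub_zero]
    refine ⟨?_, fun n => ?_, fun n => ?_, ?_⟩
    · rw [hs, Telegraph.negMeander_eq_posMeander_swapStates,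
        Telegraph.posMeander_zero hε.swapStates hlam' hγ0' ht h' hB', sub_zero,
        Telegraph.dirac_neg_preimage hB]
    · rw [hs, Telegraph.negMeander_eq_posMeander_swapStates,
        Telegraph.posMeander_odd hε.swapStates hlam' hγ0' hγ1' ht h' hB',
        Telegraph.setLIntegral_neg_preimage hB]
      refine lintegral_congr fun x => ?_
      simp only [sub_zero, neg_mul]
      refine Telegraph.ofReal_indicator_Ioo_neg _ (fun x => ?_) x
      simp only [Telegraph.oddDensity, Telegraph.xi0_swapStates, Telegraph.xi1_swapStates,
        Telegraph.zfun_swapStates, Telegraph.theta_swapStates,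
        sub_zero, sub_self]
      ring
    · rw [hs, Telegraph.negMeander_eq_posMeander_swapStates,
        Telegraph.posMeander_even hε.swapStates hlam' hγ0' hγ1' ht h' hB',
        Telegraph.setLIntegral_neg_preimage hB]
      refine lintegral_congr fun x => ?_
      simp only [sub_zero, neg_mul]
      refine Telegraph.ofReal_indicator_Ioo_neg _ (fun x => ?_) x
      simp only [Telegraph.evenDensity, Telegraph.zfun_swapStates, Telegraph.theta_swapStates,
        sub_zero, sub_self]
      ring
    · have hset : {ω | Telegraph.position γ ε t ω ∈ B ∧ Telegraph.runMax γ ε t ω = 0}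
          = {ω | Telegraph.position (fun i => -γ (1 - i)) (Telegraph.swapStates ε) t ω
              ∈ Neg.neg ⁻¹' B ∧
            Telegraph.runMin (fun i => -γ (1 - i)) (Telegraph.swapStates ε) t ω = 0} := by
        simp [Telegraph.position_swapStates, Telegraph.runMin_swapStates]
      rw [hs, hset, Telegraph.posMeander_total hε.swapStates hlam' hγ0' hγ1' ht h' hB',
        Telegraph.setLIntegral_neg_preimage hB, sub_zero, Telegraph.dirac_neg_preimage hB]
      congr 1
      refine lintegral_congr fun x => ?_
      rw [neg_mul]
      refine Telegraph.ofReal_indicator_Ioo_neg _ (fun x => ?_) x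
      simp only [Telegraph.totalDensity, Telegraph.calI0, Telegraph.calI1, Telegraph.xi0_swapStates,
        Telegraph.xi1_swapStates, Telegraph.zfun_swapStates, Telegraph.theta_swapStates,
        sub_zero, sub_self]
      ring
  · have h0 := Telegraph.xi0_pos hγ0 hγ1 hx.1
    have h1 := Telegraph.xi1_pos hγ0 hγ1 hx.2
    have hz : 0 < Telegraph.zfun lam γ t x :=
      mul_pos (mul_pos (mul_pos (hlam 0) (hlam 1)) h0) h1
    exact ⟨Telegraph.calI0_eq_besselI hz.le, Telegraph.calI1_eq_besselI hz⟩
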